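/- Let $n\ge 1$ be an integer and $\nu=1/n$. Let $\mathfrak H_\nu$ be a $\nu$-stable subordinator, i.e. a process with $\mathfrak H_\nu(0)=0$, independent stationary increments, nondecreasing right-continuous paths and $\mathbb E\,e^{-\lambda \mathfrak H_\nu(x)}=e^{-x\lambda^\nu}$ for $x,\lambda\ge 0$, and let $\mathfrak L^\nu(t)=\inf\{x\ge 0:\mathfrak H_\nu(x)>t\}$ be its inverse. Let $D^k_{0-,z}=(-1)^k\partial^k/\partial z^k$ and $\Phi_\alpha(z)=\frac{1}{\Gamma(1-\alpha)}z^{-\alpha}$ for $z>0$, $\Phi_\alpha(z)=0$ for $z\le 0$, where $1/\Gamma(0)=0$, so that $\Phi_1=0$. (1) Let $n\ge 2$. For $t>0$ put $$l_\nu(x,t)=t^{-\nu}\,W_{-\nu,1-\nu}(-x t^{-\nu}),\qquad W_{\alpha,\beta}(z)=\sum_{k\ge 0}\frac{z^k}{k!\,\Gamma(\alpha k+\beta)},$$ with $1/\Gamma=0$ at the poles of $\Gamma$. For every $t>0$ the law of $\mathfrak L^\nu(t)$ is the measure on $(0,\infty)$ with density $l_\nu(\cdot,t)\ge 0$. The function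 $l_\nu$ is infinitely differentiable in each variable on $x>0$, $t>0$, and $$\left(D_{0-,t}+D^n_{0-,x}\right)l_\nu(x,t)=0,\qquad x>0,\ t>0.$$ It satisfies the initial condition $l_\nu(x,0)=\delta(x)$, i.e. $l_\nu(\cdot,t)$ is integrable on $(0,\infty)$ for $t>0$ and $\int_0^\infty f(x)\,l_\nu(x,t)\,dx\to f(0)$ as $t\to0^+$ for every bounded continuous $f$. It satisfies the boundary conditions $l_\nu(0,t)=\Phi_\nu(t)$ and $$D^k_{0-,x}\,l_\nu(x,t)\big|_{x=0^+}=\Phi_{(k+1)/n}(t),\qquad 0\le k<n,\ t>0,$$ where $|_{x=0^+}$ denotes the limit as $x\to0^+$. (2) Let $n=1$. For every $t>0$ the law of $\mathfrak L^1(t)$ is the unit mass $\delta_t$. The family of these laws solves $(D_{0-,t}+D_{0-,x})\,l=0$ on $x>0$, $t>0$ in the sense of distributions and converges weakly to $\delta_0$ as $t\to0^+$. The law at time $t$ gives no mass to $(-\infty,t)$, so that its value at the boundary point $x=0$ is $0=\Phi_1(t)$. -/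

import Mathlib

open MeasureTheory ProbabilityTheory Filter Set Topology
open scoped NNReal

noncomputable section

namespace InverseStable

/-- The Wright function `W_{α,β}(z) = ∑ z^k / (k! Γ(αk+β))`. Since `Real.Gamma` is `0` at the poles
of the Gamma function, the terms with a pole in the denominator vanish, which is the usual
convention `1/Γ(-m) = 0`. -/
def wright (α β z : ℝ) : ℝ :=
  ∑' k : ℕ, z ^ k / ((k.factorial : ℝ) * Real.Gamma (α * k + β))

/-- `l_ν(x,t) = t^{-ν} W_{-ν,1-ν}(-x t^{-ν})`. -/
def invDensity (ν x t : ℝ) : ℝ :=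
  t ^ (-ν) * wright (-ν) (1 - ν) (-x * t ^ (-ν))

/-- `Φ_α(z) = H(z) z^{-α} / Γ(1-α)`; at `α = 1` it is `0` (convention `1/Γ(0) = 0`). -/
def Phi (α z : ℝ) : ℝ :=
  (1 / Real.Gamma (1 - α)) * (if 0 < z then z ^ (-α) else 0)

/-- The derivative `D^n_{0-} = (-1)^n d^n/dz^n` of integer order `n`. -/
def DMinus (n : ℕ) (f : ℝ → ℝ) (z : ℝ) : ℝ :=
  (-1) ^ n * iteratedDeriv n f z

/-- `H` is a stable subordinator of index `ν`: a process with `H 0 = 0`, independent and stationary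
increments, nondecreasing right-continuous paths, and `E exp (-s H t) = exp (-t s^ν)`. -/
structure IsStableSubordinator {Ω : Type*} [MeasurableSpace Ω] (ν : ℝ) (H : ℝ≥0 → Ω → ℝ)
    (P : Measure Ω) : Prop where
  measurable : ∀ x, Measurable (H x)
  zero : ∀ᵐ ω ∂P, H 0 ω = 0
  indep : HasIndepIncrements H P
  stationary : ∀ x y, P.map (fun ω => H (x + y) ω - H x ω) = P.map (H y)
  mono : ∀ᵐ ω ∂P, Monotone (fun x => H x ω)
  rightCont : ∀ᵐ ω ∂P, ∀ x, ContinuousWithinAt (fun y => H y ω) (Ici x) x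
  laplace : ∀ (x : ℝ≥0) (s : ℝ), 0 ≤ s →
    ∫ ω, Real.exp (-s * H x ω) ∂P = Real.exp (-(x : ℝ) * s ^ ν)

/-- The inverse process `L t = inf {x ≥ 0 : H x > t}`. -/
def inverseProcess {Ω : Type*} (H : ℝ≥0 → Ω → ℝ) (t : ℝ) (ω : Ω) : ℝ :=
  ((sInf {x : ℝ≥0 | t < H x ω} : ℝ≥0) : ℝ)

/-- A family of measures `m t`, `t > 0`, on the line solves `(D_{0-,t} + D^n_{0-,x}) m = 0` on
`x > 0`, `t > 0` in the sense of distributions. The formal adjoints of `D_{0-,t} = -∂_t` and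
`D^n_{0-,x} = (-1)^n ∂_x^n` are `∂_t` and `∂_x^n`. -/
def SolvesInDistributions (n : ℕ) (m : ℝ → Measure ℝ) : Prop :=
  ∀ φ : ℝ × ℝ → ℝ, ContDiff ℝ (⊤ : ℕ∞) φ → HasCompactSupport φ →
    tsupport φ ⊆ Ioi (0 : ℝ) ×ˢ Ioi (0 : ℝ) →
    ∫ t in Ioi (0 : ℝ), ∫ x, (deriv (fun s => φ (x, s)) t +
      iteratedDeriv n (fun y => φ (y, t)) x) ∂(m t) = 0

end InverseStable

end

/-! For n ≥ 2, put ω = exp(iπ/n). Everything analytic rests on `invDensity_eq_contour`, l(x,t) =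
(n/π) Im ∫₀^∞ ω exp(-xvω) exp(-t vⁿ) dv. Expanding exp(-xvω) and integrating termwise gives
Γ((k+1)/n) sin(π(k+1)/n), which the reflection formula turns into 1/Γ(1-(k+1)/n). The same expansion
proves that the Wright series is entire. Derivatives in x shift its coefficients, so the boundary
values are the coefficients themselves, and the equation is the recursion `wrightCoeff_add`.

The link with the subordinator is the Laplace transform in t. For the contour integral it replaces
exp(-t vⁿ) by 1/(1+vⁿ). Moving the ray through ω onto the positive axis, after cancelling the pole
at 1, gives e^{-x} at s = 1 (`laplace_one_invDensity`), and self-similarity gives s^{ν-1} exp(-x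
s^ν) for every s > 0. Integrating in x yields s⁻¹(1 - exp(-x s^ν)), which is also the transform of t
↦ P(H x > t). Uniqueness of the transform identifies P(H x > t) with the primitive of the density
(`measureReal_lt_eq`). Nonnegativity follows because P(H x > t) increases with x, and the law of the
inverse follows because {L t ≤ x} and {H x > t} have the same probability. The bound O(z⁻²) in
`exists_abs_expGen_wrightCoeff_le` supplies the integrability behind Fubini and the initial
condition.

For n = 1, exp(-(H x - x)) has mean 1 and second moment 1, so H x = x almost surely and everything
is explicit. -/

namespace InverseStable

/-! ### Exponential generating functions -/

/-- The exponential generating function of the sequence `a`. -/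
noncomputable def expGen (a : ℕ → ℝ) (z : ℝ) : ℝ :=
  ∑' k : ℕ, a k * z ^ k / (k.factorial : ℝ)

/-- The exponential generating function of `a` converges on the whole line. -/
def ExpGenConverges (a : ℕ → ℝ) : Prop :=
  ∀ r : ℝ, Summable fun k : ℕ => a k * r ^ k / (k.factorial : ℝ)

/-- The shift costs a factor k + 1 from the factorial; it is at most 2^(k+1), so convergence at
twice the radius absorbs it. -/
theorem ExpGenConverges.shift {a : ℕ → ℝ} (ha : ExpGenConverges a) :
    ExpGenConverges fun k => a (k + 1) := by
  intro r
  set R : ℝ := max |r| 1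
  have h1 : 1 ≤ R := le_max_right _ _
  have hs := ((summable_nat_add_iff 1).2 (ha (2 * R))).norm
  refine Summable.of_norm_bounded hs fun k => ?_
  have hf : ((k + 1).factorial : ℝ) = (k + 1) * k.factorial := by
    push_cast [Nat.factorial_succ]; ring
  have hk : ((k : ℝ) + 1) ≤ 2 ^ (k + 1) := by
    exact_mod_cast (Nat.lt_two_pow_self (n := k + 1)).le
  have hr : |r| ^ k ≤ R ^ (k + 1) :=
    (pow_le_pow_left₀ (abs_nonneg r) (le_max_left _ _) k).trans (pow_le_pow_right₀ h1 (by lia))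
  have hfp : (0 : ℝ) < k.factorial := by positivity
  have hR : |R| = R := abs_of_pos (by linarith)
  simp only [norm_div, norm_mul, norm_pow, Real.norm_eq_abs, abs_two, hR, Nat.abs_cast]
  rw [hf, div_le_div_iff₀ hfp (by positivity), mul_pow]
  have : ((k : ℝ) + 1) * |r| ^ k ≤ 2 ^ (k + 1) * R ^ (k + 1) := by gcongr
  nlinarith [mul_le_mul_of_nonneg_left this (mul_nonneg (abs_nonneg (a (k + 1))) hfp.le)]

theorem ExpGenConverges.hasDerivAt {a : ℕ → ℝ} (ha : ExpGenConverges a) (z : ℝ) :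
    HasDerivAt (expGen a) (expGen (fun k => a (k + 1)) z) z := by
  set R : ℝ := |z| + 1
  have hR : 0 < R := by positivity
  have hterm (k : ℕ) (y : ℝ) : HasDerivAt (fun y => a k * y ^ k / (k.factorial : ℝ))
      (a k * (k * y ^ (k - 1)) / (k.factorial : ℝ)) y :=
    ((hasDerivAt_pow k y).const_mul (a k)).div_const _
  have hsucc (k : ℕ) (y : ℝ) : a (k + 1) * (((k + 1 : ℕ) : ℝ) * y ^ (k + 1 - 1)) /
      ((k + 1).factorial : ℝ) = a (k + 1) * y ^ k / (k.factorial : ℝ) := by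
    have : (0 : ℝ) < k.factorial := by positivity
    push_cast [Nat.factorial_succ]
    field_simp
  have hsum (y : ℝ) : Summable fun k : ℕ => a k * (k * y ^ (k - 1)) / (k.factorial : ℝ) := by
    refine (summable_nat_add_iff 1).1 ?_
    simpa only [hsucc] using ha.shift y
  have hd := hasDerivAt_tsum_of_isPreconnected (t := Metric.ball (0 : ℝ) R) (hsum R).norm
    Metric.isOpen_ball (convex_ball _ _).isPreconnected (fun k y _ => hterm k y)
    (fun k y hy => ?_) (Metric.mem_ball_self hR) (ha 0) (y := z) (by simp [R])
  · have he : expGen (fun k => a (k + 1)) z =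
        ∑' k : ℕ, a k * (k * z ^ (k - 1)) / (k.factorial : ℝ) := by
      rw [(hsum z).tsum_eq_zero_add]
      simp only [hsucc]
      simp [expGen]
    rw [he]
    exact hd
  · have hy' : |y| ≤ R := by simpa using (mem_ball_zero_iff.1 hy).le
    simp only [norm_div, norm_mul, norm_pow, Real.norm_eq_abs, abs_of_pos hR, Nat.abs_cast]
    gcongr

theorem ExpGenConverges.shift_iterate {a : ℕ → ℝ} (ha : ExpGenConverges a) (m : ℕ) :
    ExpGenConverges fun k => a (k + m) := by
  induction m with
  | zero => exact ha
  | succ m ih => simpa only [add_right_comm _ 1 m, add_assoc] using ih.shift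

theorem ExpGenConverges.iteratedDeriv_eq {a : ℕ → ℝ} (ha : ExpGenConverges a) (m : ℕ) :
    iteratedDeriv m (expGen a) = expGen fun k => a (k + m) := by
  induction m with
  | zero => simp
  | succ m ih =>
    ext z
    rw [iteratedDeriv_succ, ih, ((ha.shift_iterate m).hasDerivAt z).deriv]
    simp only [add_assoc, add_comm 1 m]

theorem ExpGenConverges.contDiff {a : ℕ → ℝ} (ha : ExpGenConverges a) :
    ContDiff ℝ (⊤ : ℕ∞) (expGen a) :=
  contDiff_of_differentiable_iteratedDeriv fun m _ => by
    rw [ha.iteratedDeriv_eq]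
    exact fun z => ((ha.shift_iterate m).hasDerivAt z).differentiableAt

theorem expGen_zero (a : ℕ → ℝ) : expGen a 0 = a 0 := by
  rw [expGen, tsum_eq_single 0 fun k hk => by simp [hk]]
  simp

/-! ### Coefficients of the Wright function -/

/-- The coefficients of `W_{-1/n,1-1/n}`. -/
noncomputable def wrightCoeff (n k : ℕ) : ℝ :=
  1 / Real.Gamma (1 - ((k : ℝ) + 1) / n)

theorem wright_eq_expGen (n : ℕ) :
    wright (-(1 / (n : ℝ))) (1 - 1 / (n : ℝ)) = expGen (wrightCoeff n) := by
  ext z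
  refine tsum_congr fun k => ?_
  have : -(1 / (n : ℝ)) * k + (1 - 1 / (n : ℝ)) = 1 - ((k : ℝ) + 1) / n := by ring
  rw [this, wrightCoeff]
  simp only [div_eq_mul_inv, mul_inv_rev]
  ring

/-- Inverting the reflection formula keeps it valid at integer s: there both `Real.Gamma (1 - s)`
and the sine are 0, and division by 0 gives 0. -/
theorem one_div_Gamma_one_sub {s : ℝ} (hs : 0 < s) :
    1 / Real.Gamma (1 - s) = Real.Gamma s * Real.sin (Real.pi * s) / Real.pi := by
  have h := congrArg (·⁻¹) (Real.Gamma_mul_Gamma_one_sub s)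
  simp only [mul_inv_rev, inv_div] at h
  have hG := (Real.Gamma_pos_of_pos hs).ne'
  rw [one_div, ← mul_div_assoc', ← h]
  field_simp

/-- Raising the index by n lowers the Gamma argument by 1, so this is Γ(1-s) = -s Γ(-s). It becomes
the differential equation. -/
theorem wrightCoeff_add (n : ℕ) (hn : 1 ≤ n) (k : ℕ) :
    wrightCoeff n (k + n) = -(((k : ℝ) + 1) / n) * wrightCoeff n k := by
  have hn0 : (0 : ℝ) < n := by exact_mod_cast hn
  set s : ℝ := ((k : ℝ) + 1) / n with hs
  have hs0 : 0 < s := by positivity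
  have h1 : 1 - (((k + n : ℕ) : ℝ) + 1) / n = -s := by
    rw [hs]; push_cast; field_simp; ring
  have h2 : Real.Gamma (1 - s) = -s * Real.Gamma (-s) := by
    rw [← Real.Gamma_add_one (by linarith)]; ring_nf
  rw [wrightCoeff, wrightCoeff, h1, ← hs, h2]
  field_simp

/-! ### The contour integral -/

/-- The primitive `2n`-th root of unity `exp (iπ/n)`. -/
noncomputable def sectorRoot (n : ℕ) : ℂ :=
  Complex.exp ((Real.pi / n : ℝ) * Complex.I)

theorem norm_sectorRoot (n : ℕ) : ‖sectorRoot n‖ = 1 :=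
  Complex.norm_exp_ofReal_mul_I _

theorem sectorRoot_ne_zero (n : ℕ) : sectorRoot n ≠ 0 :=
  Complex.exp_ne_zero _

theorem sectorRoot_re_nonneg {n : ℕ} (hn : 2 ≤ n) : 0 ≤ (sectorRoot n).re := by
  have hn' : (2 : ℝ) ≤ n := by exact_mod_cast hn
  rw [sectorRoot, Complex.exp_ofReal_mul_I_re]
  apply Real.cos_nonneg_of_neg_pi_div_two_le_of_le
  · have : 0 ≤ Real.pi / n := by positivity
    linarith [Real.pi_pos]
  · exact div_le_div_of_nonneg_left Real.pi_pos.le two_pos hn'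

theorem sectorRoot_pow (n : ℕ) (hn : 1 ≤ n) : sectorRoot n ^ n = -1 := by
  have hn0 : (n : ℂ) ≠ 0 := by exact_mod_cast (by lia : n ≠ 0)
  rw [sectorRoot, ← Complex.exp_nat_mul, ← Complex.exp_pi_mul_I]
  congr 1
  push_cast
  field_simp

theorem sectorRoot_pow_im (n k : ℕ) :
    (sectorRoot n ^ k).im = Real.sin (Real.pi * (k / n)) := by
  rw [sectorRoot, ← Complex.exp_nat_mul, ← mul_assoc]
  have : (k : ℂ) * ((Real.pi / n : ℝ) : ℂ) = ((Real.pi * (k / n) : ℝ) : ℂ) := by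
    push_cast; ring
  rw [this, Complex.exp_ofReal_mul_I_im]

/-- A Gaussian dominates, since vⁿ ≥ v² - 1 for v > 0. This is the domination for the termwise
integration in `hasSum_contour`. -/
theorem integrableOn_exp_linear_sub_pow {n : ℕ} (hn : 2 ≤ n) (r : ℝ) {t : ℝ} (ht : 0 < t) :
    IntegrableOn (fun v : ℝ => Real.exp (r * v) * Real.exp (-t * v ^ n)) (Ioi 0) := by
  have hg : Integrable fun v : ℝ => Real.exp t * Real.exp (-t * v ^ 2 + r * v) := by
    refine Integrable.const_mul ?_ _
    have := (integrable_cexp_quadratic (b := (t : ℂ)) (by simpa using ht) (r : ℂ) 0).re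
    refine this.congr (ae_of_all _ fun v => ?_)
    have : -(t : ℂ) * (v : ℂ) ^ 2 + (r : ℂ) * v + 0 = ((-t * v ^ 2 + r * v : ℝ) : ℂ) := by
      push_cast; ring
    simp only [this, ← Complex.ofReal_exp]
    exact Complex.ofReal_re _
  refine hg.integrableOn.mono' (by fun_prop) ?_
  filter_upwards [ae_restrict_mem measurableSet_Ioi] with v hv
  have hv : 0 < v := hv
  have hpow : v ^ 2 - 1 ≤ v ^ n := by
    rcases le_total v 1 with h | h
    · nlinarith [pow_pos hv n]
    · linarith [pow_le_pow_right₀ h hn]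
  rw [Real.norm_of_nonneg (by positivity), ← Real.exp_add, ← Real.exp_add]
  refine Real.exp_le_exp.2 ?_
  nlinarith

/-- The integrand of the contour integral for `l_{1/n}(x,t)`. -/
noncomputable def contourKernel (n : ℕ) (x t v : ℝ) : ℂ :=
  sectorRoot n * Complex.exp (-(x * v : ℝ) * sectorRoot n) * (Real.exp (-t * v ^ n) : ℂ)

theorem integral_pow_mul_exp_neg_pow {n : ℕ} (hn : 1 ≤ n) (k : ℕ) {t : ℝ} (ht : 0 < t) :
    ∫ v in Ioi (0 : ℝ), v ^ k * Real.exp (-t * v ^ n) =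
      t ^ (-(((k : ℝ) + 1) / n)) * (1 / n) * Real.Gamma (((k : ℝ) + 1) / n) := by
  have h := integral_rpow_mul_exp_neg_mul_rpow (p := n) (q := k) (b := t)
    (by exact_mod_cast hn) (by linarith [Nat.cast_nonneg (α := ℝ) k]) ht
  simpa only [Real.rpow_natCast, neg_div] using h

/-- The k-th term of exp(-xvω) contributes ω^(k+1) times a real Gamma integral. Its imaginary part
carries sin(π(k+1)/n), and reflection produces the coefficient. -/
theorem hasSum_contour {n : ℕ} (hn : 2 ≤ n) (x : ℝ) {t : ℝ} (ht : 0 < t) :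
    HasSum (fun k : ℕ => wrightCoeff n k * (-x) ^ k / (k.factorial : ℝ) *
        t ^ (-(((k : ℝ) + 1) / n)))
      (n / Real.pi * (∫ v in Ioi (0 : ℝ), contourKernel n x t v).im) := by
  have hn0 : (0 : ℝ) < n := by exact_mod_cast (by lia : 0 < n)
  set F : ℕ → ℝ → ℂ := fun k v => sectorRoot n * ((-(x * v : ℝ) * sectorRoot n) ^ k /
    (k.factorial : ℂ)) * (Real.exp (-t * v ^ n) : ℂ) with hF
  have hexp (r : ℝ) : HasSum (fun k : ℕ => r ^ k / (k.factorial : ℝ)) (Real.exp r) := by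
    have := NormedSpace.exp_series_hasSum_exp' (𝕂 := ℝ) r
    simpa [Real.exp_eq_exp_ℝ, div_eq_inv_mul] using this
  have hcexp (z : ℂ) : HasSum (fun k : ℕ => z ^ k / (k.factorial : ℂ)) (Complex.exp z) := by
    have := NormedSpace.exp_series_hasSum_exp' (𝕂 := ℂ) z
    simpa [Complex.exp_eq_exp_ℂ, div_eq_inv_mul] using this
  have hb (v : ℝ) : HasSum (fun k : ℕ => (|x| * v) ^ k / (k.factorial : ℝ) *
      Real.exp (-t * v ^ n)) (Real.exp (|x| * v) * Real.exp (-t * v ^ n)) :=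
    (hexp _).mul_right _
  have key : HasSum (fun k => ∫ v in Ioi (0 : ℝ), F k v)
      (∫ v in Ioi (0 : ℝ), contourKernel n x t v) := by
    refine hasSum_integral_of_dominated_convergence
      (fun k v => (|x| * v) ^ k / (k.factorial : ℝ) * Real.exp (-t * v ^ n))
      (fun k => by fun_prop) (fun k => ?_) (ae_of_all _ fun v => (hb v).summable) ?_
      (ae_of_all _ fun v => ((hcexp _).mul_left _).mul_right _)
    · filter_upwards [ae_restrict_mem measurableSet_Ioi] with v hv
      have hv : 0 < v := hv
      simp only [hF, norm_mul, norm_div, norm_pow, norm_neg, norm_sectorRoot, mul_one, one_mul,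
        Complex.norm_real, Complex.norm_natCast, Real.norm_eq_abs, Real.abs_exp,
        abs_of_pos hv]
      exact le_rfl
    · simp only [fun v => (hb v).tsum_eq]
      exact integrableOn_exp_linear_sub_pow hn _ ht
  have him := (Complex.hasSum_im key).mul_left (n / Real.pi)
  suffices h : ∀ k : ℕ, wrightCoeff n k * (-x) ^ k / (k.factorial : ℝ) *
      t ^ (-(((k : ℝ) + 1) / n)) = n / Real.pi * (∫ v in Ioi (0 : ℝ), F k v).im by
    simpa only [h] using him
  intro k
  have h1 : ∀ v : ℝ, F k v = (((-x) ^ k / (k.factorial : ℝ) : ℝ) * sectorRoot n ^ (k + 1)) *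
      ((v ^ k * Real.exp (-t * v ^ n) : ℝ) : ℂ) := by
    intro v
    simp only [hF]
    push_cast
    ring
  simp only [h1]
  rw [integral_const_mul, integral_complex_ofReal, integral_pow_mul_exp_neg_pow (by lia) k ht,
    Complex.im_mul_ofReal, Complex.im_ofReal_mul, sectorRoot_pow_im, wrightCoeff,
    one_div_Gamma_one_sub (by positivity)]
  push_cast
  field_simp

/-- No growth estimate for Γ is needed: at t = 1 the sum in `hasSum_contour` is exactly this series.
-/
theorem wrightCoeff_converges {n : ℕ} (hn : 2 ≤ n) : ExpGenConverges (wrightCoeff n) := by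
  intro r
  simpa using (hasSum_contour hn (-r) one_pos).summable

theorem invDensity_eq_expGen (n : ℕ) (x t : ℝ) :
    invDensity (1 / (n : ℝ)) x t =
      t ^ (-(1 / (n : ℝ))) * expGen (wrightCoeff n) (-x * t ^ (-(1 / (n : ℝ)))) := by
  rw [invDensity, wright_eq_expGen]

theorem invDensity_eq_contour {n : ℕ} (hn : 2 ≤ n) (x : ℝ) {t : ℝ} (ht : 0 < t) :
    invDensity (1 / (n : ℝ)) x t =
      n / Real.pi * (∫ v in Ioi (0 : ℝ), contourKernel n x t v).im := by
  rw [invDensity_eq_expGen, ← (hasSum_contour hn x ht).tsum_eq, expGen, ← tsum_mul_left]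
  refine tsum_congr fun k => ?_
  have h : -(((k : ℝ) + 1) / n) = -(1 / (n : ℝ)) + -(1 / (n : ℝ)) * k := by ring
  rw [mul_pow, ← Real.rpow_mul_natCast ht.le, h, Real.rpow_add ht]
  ring

theorem expGen_eq_contour {n : ℕ} (hn : 2 ≤ n) (z : ℝ) :
    expGen (wrightCoeff n) (-z) =
      n / Real.pi * (∫ v in Ioi (0 : ℝ), contourKernel n z 1 v).im := by
  rw [← invDensity_eq_contour hn z one_pos, invDensity_eq_expGen]
  simp

/-! ### Smoothness, the equation and the boundary values -/

theorem contDiffOn_invDensity_left {n : ℕ} (hn : 2 ≤ n) (t : ℝ) :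
    ContDiffOn ℝ (⊤ : ℕ∞) (fun x => invDensity (1 / (n : ℝ)) x t) (Ioi 0) := by
  simp only [invDensity_eq_expGen]
  have := (wrightCoeff_converges hn).contDiff
  exact (contDiff_const.mul (this.comp (contDiff_id.neg.mul contDiff_const))).contDiffOn

theorem contDiffOn_invDensity_right {n : ℕ} (hn : 2 ≤ n) (x : ℝ) :
    ContDiffOn ℝ (⊤ : ℕ∞) (fun t => invDensity (1 / (n : ℝ)) x t) (Ioi 0) := by
  simp only [invDensity_eq_expGen]
  have hp : ContDiffOn ℝ (⊤ : ℕ∞) (fun t : ℝ => t ^ (-(1 / (n : ℝ)))) (Ioi 0) :=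
    contDiffOn_id.rpow_const_of_ne fun t ht => (mem_Ioi.1 ht).ne'
  exact hp.mul ((wrightCoeff_converges hn).contDiff.comp_contDiffOn (contDiffOn_const.mul hp))

theorem dMinus_invDensity {n : ℕ} (hn : 2 ≤ n) (k : ℕ) (x : ℝ) {t : ℝ} (ht : 0 < t) :
    DMinus k (fun y => invDensity (1 / (n : ℝ)) y t) x =
      t ^ (-(((k : ℝ) + 1) / n)) *
        expGen (fun j => wrightCoeff n (j + k)) (-x * t ^ (-(1 / (n : ℝ)))) := by
  set c : ℝ := t ^ (-(1 / (n : ℝ))) with hc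
  have hf : (fun y => invDensity (1 / (n : ℝ)) y t) =
      fun y => c * expGen (wrightCoeff n) ((-c) * y) := by
    ext y
    rw [invDensity_eq_expGen, ← hc]
    ring_nf
  have hcd := (wrightCoeff_converges hn).contDiff
  have h1 : t ^ (-(((k : ℝ) + 1) / n)) = c ^ (k + 1) := by
    rw [hc, ← Real.rpow_mul_natCast ht.le]
    push_cast
    ring_nf
  have h2 := iteratedDeriv_comp_const_mul (n := k) (hcd.of_le (by exact_mod_cast le_top)) (-c)
  rw [DMinus, hf, iteratedDeriv_const_mul_field, h2,
    (wrightCoeff_converges hn).iteratedDeriv_eq, h1]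
  have h3 : (-c) * x = -x * c := by ring
  have h4 : (-1 : ℝ) ^ k * (-1) ^ k = 1 := by rw [← mul_pow]; simp
  beta_reduce
  rw [h3, neg_pow c]
  linear_combination (c ^ (k + 1) * expGen (fun j => wrightCoeff n (j + k)) (-x * c)) * h4

/-- The operator z d/dz multiplies the k-th term by k, so the bracket has terms (k+1) times the
original ones; `wrightCoeff_add` cancels them one by one. -/
theorem expGen_wrightCoeff_ode {n : ℕ} (hn : 2 ≤ n) (z : ℝ) :
    1 / (n : ℝ) * (expGen (wrightCoeff n) z + z * expGen (fun k => wrightCoeff n (k + 1)) z) +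
      expGen (fun k => wrightCoeff n (k + n)) z = 0 := by
  have hc := wrightCoeff_converges hn
  have h0 := (hc z).hasSum
  have h1 : HasSum (fun k : ℕ => (k : ℝ) * (wrightCoeff n k * z ^ k / (k.factorial : ℝ)))
      (z * expGen (fun k => wrightCoeff n (k + 1)) z) := by
    rw [← hasSum_nat_add_iff' 1]
    have := (hc.shift z).hasSum.mul_left z
    simp only [Finset.sum_range_one, Nat.cast_zero, zero_mul, sub_zero]
    have he (k : ℕ) : ((k + 1 : ℕ) : ℝ) * (wrightCoeff n (k + 1) * z ^ (k + 1) /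
        ((k + 1).factorial : ℝ)) =
        z * (wrightCoeff n (k + 1) * z ^ k / (k.factorial : ℝ)) := by
      have : (0 : ℝ) < k.factorial := by positivity
      push_cast [Nat.factorial_succ]
      field_simp
      ring
    simp only [he]
    exact this
  have h2 := (hc.shift_iterate n z).hasSum
  have h := ((h0.add h1).mul_left (1 / (n : ℝ))).add h2
  refine h.unique ?_
  convert hasSum_zero using 2 with k
  beta_reduce
  rw [wrightCoeff_add n (by lia)]
  ring

theorem invDensity_equation {n : ℕ} (hn : 2 ≤ n) (x : ℝ) {t : ℝ} (ht : 0 < t) :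
    DMinus 1 (fun s => invDensity (1 / (n : ℝ)) x s) t +
      DMinus n (fun y => invDensity (1 / (n : ℝ)) y t) x = 0 := by
  have hn0 : (0 : ℝ) < n := by exact_mod_cast (by lia : 0 < n)
  have hp : HasDerivAt (fun s : ℝ => s ^ (-(1 / (n : ℝ))))
      (-(1 / (n : ℝ)) * t ^ (-(1 / (n : ℝ)) - 1)) t :=
    Real.hasDerivAt_rpow_const (Or.inl ht.ne')
  have hd := hp.mul (((wrightCoeff_converges hn).hasDerivAt (-x * t ^ (-(1 / (n : ℝ))))).comp t
    (hp.const_mul (-x)))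
  have hf : (fun s => invDensity (1 / (n : ℝ)) x s) = (fun s : ℝ => s ^ (-(1 / (n : ℝ)))) *
      expGen (wrightCoeff n) ∘ fun y => -x * y ^ (-(1 / (n : ℝ))) :=
    funext fun s => invDensity_eq_expGen n x s
  rw [dMinus_invDensity hn n x ht, DMinus, iteratedDeriv_one, hf, hd.deriv]
  have ho := expGen_wrightCoeff_ode hn (-x * t ^ (-(1 / (n : ℝ))))
  have h1 : t ^ (-(((n : ℝ) + 1) / n)) = t ^ (-(1 / (n : ℝ)) - 1) := by
    congr 1
    field_simp
    ring
  rw [h1]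
  simp only [Function.comp_apply]
  linear_combination t ^ (-(1 / (n : ℝ)) - 1) * ho

theorem tendsto_dMinus_invDensity {n : ℕ} (hn : 2 ≤ n) (k : ℕ) {t : ℝ} (ht : 0 < t) :
    Tendsto (fun x => DMinus k (fun y => invDensity (1 / (n : ℝ)) y t) x)
      (𝓝[>] 0) (𝓝 (Phi (((k : ℝ) + 1) / (n : ℝ)) t)) := by
  simp only [dMinus_invDensity hn k _ ht]
  have hc : Continuous (expGen fun j => wrightCoeff n (j + k)) :=
    ((wrightCoeff_converges hn).shift_iterate k).contDiff.continuous
  have h : Continuous fun x => t ^ (-(((k : ℝ) + 1) / n)) *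
      expGen (fun j => wrightCoeff n (j + k)) (-x * t ^ (-(1 / (n : ℝ)))) := by fun_prop
  have h0 : t ^ (-(((k : ℝ) + 1) / n)) *
      expGen (fun j => wrightCoeff n (j + k)) (-0 * t ^ (-(1 / (n : ℝ)))) =
      Phi (((k : ℝ) + 1) / (n : ℝ)) t := by
    rw [neg_zero, zero_mul, expGen_zero, Phi, if_pos ht, wrightCoeff, zero_add, mul_comm]
  rw [← h0]
  exact h.continuousWithinAt

theorem invDensity_zero_left {n : ℕ} {t : ℝ} (ht : 0 < t) :
    invDensity (1 / (n : ℝ)) 0 t = Phi (1 / (n : ℝ)) t := by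
  rw [invDensity_eq_expGen, neg_zero, zero_mul, expGen_zero, Phi, if_pos ht, wrightCoeff,
    Nat.cast_zero, zero_add, mul_comm]

/-! ### Decay and integrability in space -/

theorem integrableOn_pow_mul_exp_neg_pow {n : ℕ} (hn : 1 ≤ n) (k : ℕ) :
    IntegrableOn (fun v : ℝ => v ^ k * Real.exp (-v ^ n)) (Ioi 0) := by
  -- A non-integrable function has Bochner integral 0, while the known value is a positive Gamma
  -- factor.
  by_contra h
  have h1 := integral_pow_mul_exp_neg_pow hn k one_pos
  have hn0 : (0 : ℝ) < n := by exact_mod_cast hn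
  simp only [neg_mul, one_mul] at h1
  rw [integral_undef h, Real.one_rpow, one_mul] at h1
  have : 0 < Real.Gamma (((k : ℝ) + 1) / n) := Real.Gamma_pos_of_pos (by positivity)
  have : 0 < 1 / (n : ℝ) * Real.Gamma (((k : ℝ) + 1) / n) := by positivity
  exact this.ne h1

theorem tendsto_pow_mul_exp_neg_pow {n : ℕ} (hn : 1 ≤ n) (k : ℕ) :
    Tendsto (fun v : ℝ => v ^ k * Real.exp (-v ^ n)) atTop (𝓝 0) := by
  refine squeeze_zero' ?_ ?_ (Real.tendsto_pow_mul_exp_neg_atTop_nhds_zero k)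
  · filter_upwards [eventually_ge_atTop 0] with v hv
    positivity
  · filter_upwards [eventually_ge_atTop 1] with v hv
    have : v ≤ v ^ n := le_self_pow₀ hv (by lia)
    gcongr

theorem norm_exp_sector_le_one {n : ℕ} (hn : 2 ≤ n) {r : ℝ} (hr : 0 ≤ r) :
    ‖Complex.exp (-(r : ℂ) * sectorRoot n)‖ ≤ 1 := by
  rw [Complex.norm_exp, Real.exp_le_one_iff, ← Complex.ofReal_neg, Complex.re_ofReal_mul]
  nlinarith [sectorRoot_re_nonneg hn]

/-- Integrate the contour integral by parts twice. The oscillating exponential has norm at most 1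
because Re ω ≥ 0, and each step gains a factor 1/z. The first boundary term is real and disappears
in the imaginary part; the second contains the derivative of exp(-vⁿ) at 0, which is 0 for n ≥ 2. -/
theorem exists_abs_expGen_wrightCoeff_le {n : ℕ} (hn : 2 ≤ n) :
    ∃ C : ℝ, ∀ z : ℝ, 0 < z → |expGen (wrightCoeff n) (-z)| ≤ C * z ^ (-2 : ℝ) := by
  have hn0 : (0 : ℝ) < n := by exact_mod_cast (by lia : 0 < n)
  obtain ⟨m, rfl⟩ : ∃ m, n = m + 2 := ⟨n - 2, by lia⟩
  set N : ℝ := ((m + 2 : ℕ) : ℝ) with hN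
  -- Below, `q1` and `q2` are the first and second derivatives of exp(-v^(m+2)).
  set ω := sectorRoot (m + 2) with hω
  set q1 : ℝ → ℝ := fun v => -N * (v ^ (m + 1) * Real.exp (-v ^ (m + 2))) with hq1
  set q2 : ℝ → ℝ := fun v => -N * (m + 1) * (v ^ m * Real.exp (-v ^ (m + 2))) +
    N ^ 2 * (v ^ (2 * m + 2) * Real.exp (-v ^ (m + 2))) with hq2
  have hq2i : IntegrableOn q2 (Ioi 0) :=
    ((integrableOn_pow_mul_exp_neg_pow (by lia) m).const_mul _).add
      ((integrableOn_pow_mul_exp_neg_pow (by lia) (2 * m + 2)).const_mul _)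
  have hd0 (v : ℝ) : HasDerivAt (fun v : ℝ => Real.exp (-v ^ (m + 2))) (q1 v) v := by
    have := ((hasDerivAt_pow (m + 2) v).neg).exp
    refine this.congr_deriv ?_
    simp only [hq1, hN, Pi.neg_apply, Nat.add_succ_sub_one]
    ring
  have hd1 (v : ℝ) : HasDerivAt q1 (q2 v) v := by
    have := (((hasDerivAt_pow (m + 1) v).mul (hd0 v)).const_mul (-N))
    refine this.congr_deriv ?_
    simp only [hq1, hq2]
    simp only [Nat.add_sub_cancel]
    push_cast
    ring
  refine ⟨N / Real.pi * ∫ v in Ioi (0 : ℝ), |q2 v|, fun z hz => ?_⟩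
  have hzc : (z : ℂ) ≠ 0 := by exact_mod_cast hz.ne'
  have hω0 : ω ≠ 0 := sectorRoot_ne_zero _
  set E : ℝ → ℂ := fun v => Complex.exp (-((z * v : ℝ) : ℂ) * ω) with hE
  have hEd (v : ℝ) : HasDerivAt E (-z * ω * E v) v := by
    have h : HasDerivAt (fun v : ℝ => -((z * v : ℝ) : ℂ) * ω) (-z * ω) v := by
      have := ((((hasDerivAt_id v).const_mul z).ofReal_comp).neg).mul_const ω
      simpa using this
    refine h.cexp.congr_deriv ?_
    simp only [hE]
    ring
  have hEn (v : ℝ) (hv : 0 ≤ v) : ‖E v‖ ≤ 1 := norm_exp_sector_le_one hn (by positivity)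
  have hEc : Continuous E := by fun_prop
  have hK (v : ℝ) : contourKernel (m + 2) z 1 v = ω * E v * (Real.exp (-v ^ (m + 2)) : ℂ) := by
    simp only [contourKernel, hE, neg_mul, one_mul]
    rfl
  have hKi : IntegrableOn (fun v => contourKernel (m + 2) z 1 v) (Ioi 0) := by
    have h0 := integrableOn_pow_mul_exp_neg_pow (n := m + 2) (by lia) 0
    refine h0.mono' (by unfold contourKernel; fun_prop) ?_
    filter_upwards [ae_restrict_mem measurableSet_Ioi] with v hv
    rw [hK, norm_mul, norm_mul, hω, norm_sectorRoot, one_mul, Complex.norm_real,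
      Real.norm_of_nonneg (by positivity), pow_zero]
    gcongr
    exact hEn v (mem_Ioi.1 hv).le
  have hQi : IntegrableOn (fun v => (q2 v : ℂ) * E v) (Ioi 0) := by
    refine hq2i.norm.mono' (by fun_prop) ?_
    filter_upwards [ae_restrict_mem measurableSet_Ioi] with v hv
    rw [norm_mul, Complex.norm_real]
    exact mul_le_of_le_one_right (norm_nonneg _) (hEn v (mem_Ioi.1 hv).le)
  -- The sum of the boundary terms of both integrations by parts; the integral of its derivative
  -- equals -`G 0`.
  set G : ℝ → ℂ := fun v =>
    -(1 / z) * (E v * (Real.exp (-v ^ (m + 2)) : ℂ)) - 1 / (z ^ 2 * ω) * (E v * (q1 v : ℂ))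
  have hGd (v : ℝ) : HasDerivAt G
      (contourKernel (m + 2) z 1 v - 1 / (z ^ 2 * ω) * ((q2 v : ℂ) * E v)) v := by
    have := (((hEd v).mul (hd0 v).ofReal_comp).const_mul (-(1 / (z : ℂ)))).sub
      (((hEd v).mul (hd1 v).ofReal_comp).const_mul (1 / ((z : ℂ) ^ 2 * ω)))
    refine this.congr_deriv ?_
    rw [hK]
    field_simp
    ring
  have hlim (f : ℝ → ℝ) (hf : Tendsto f atTop (𝓝 0)) :
      Tendsto (fun v => E v * (f v : ℂ)) atTop (𝓝 0) := by
    refine squeeze_zero_norm' ?_ (by simpa using hf.norm)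
    filter_upwards [eventually_ge_atTop 0] with v hv
    rw [norm_mul, Complex.norm_real]
    exact mul_le_of_le_one_left (norm_nonneg _) (hEn v hv)
  have hGl : Tendsto G atTop (𝓝 0) := by
    have h1 := hlim (fun v => Real.exp (-v ^ (m + 2)))
      (by simpa only [pow_zero, one_mul] using tendsto_pow_mul_exp_neg_pow (n := m + 2) (by lia) 0)
    have h2 := hlim q1 (by
      simpa only [mul_zero] using
        (tendsto_pow_mul_exp_neg_pow (n := m + 2) (by lia) (m + 1)).const_mul (-N))
    simpa only [mul_zero, sub_zero] using
      (h1.const_mul (-(1 / (z : ℂ)))).sub (h2.const_mul (1 / ((z : ℂ) ^ 2 * ω)))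
  have hG0 : G 0 = ((-(1 / z) : ℝ) : ℂ) := by simp [G, hE, hq1]
  have hint := integral_Ioi_of_hasDerivAt_of_tendsto' (fun v _ => hGd v)
    (hKi.sub (hQi.const_mul _)) hGl
  rw [integral_sub hKi (hQi.const_mul _), integral_const_mul, hG0, sub_eq_iff_eq_add] at hint
  rw [expGen_eq_contour hn, hint, zero_sub, ← Complex.ofReal_neg, Complex.add_im,
    Complex.ofReal_im, zero_add, abs_mul, abs_of_pos (by positivity), mul_assoc]
  refine mul_le_mul_of_nonneg_left ?_ (by positivity)
  refine (Complex.abs_im_le_norm _).trans ?_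
  rw [norm_mul, norm_div, norm_mul, hω, norm_sectorRoot, norm_pow, Complex.norm_real, norm_one,
    mul_one, Real.norm_of_nonneg hz.le, Real.rpow_neg hz.le, Real.rpow_ofNat, one_div, mul_comm]
  refine mul_le_mul_of_nonneg_right ?_ (by positivity)
  refine norm_integral_le_of_norm_le hq2i.abs ?_
  filter_upwards [ae_restrict_mem measurableSet_Ioi] with v hv
  rw [norm_mul, Complex.norm_real]
  exact mul_le_of_le_one_right (norm_nonneg _) (hEn v (mem_Ioi.1 hv).le)

theorem integrableOn_expGen_wrightCoeff {n : ℕ} (hn : 2 ≤ n) :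
    IntegrableOn (fun z : ℝ => expGen (wrightCoeff n) (-z)) (Ioi 0) := by
  have hc : Continuous fun z : ℝ => expGen (wrightCoeff n) (-z) :=
    (wrightCoeff_converges hn).contDiff.continuous.comp continuous_neg
  rw [← Ioc_union_Ioi_eq_Ioi zero_le_one]
  refine IntegrableOn.union ?_ ?_
  · exact (hc.integrableOn_Icc).mono_set Ioc_subset_Icc_self
  · obtain ⟨C, hC⟩ := exists_abs_expGen_wrightCoeff_le hn
    have h2 : IntegrableOn (fun z : ℝ => z ^ (-2 : ℝ)) (Ioi 1) :=
      integrableOn_Ioi_rpow_of_lt (by norm_num) one_pos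
    refine (h2.const_mul C).mono' hc.aestronglyMeasurable ?_
    filter_upwards [ae_restrict_mem measurableSet_Ioi] with z hz
    exact hC z (one_pos.trans hz)

/-! ### The time Laplace transform as a sector integral -/

/-- The time Laplace transform at `1` of the integrand `contourKernel`. -/
noncomputable def sectorKernel (n : ℕ) (x v : ℝ) : ℂ :=
  sectorRoot n * Complex.exp (-(x * v : ℝ) * sectorRoot n) * ((1 + v ^ n)⁻¹ : ℝ)

theorem integrableOn_inv_one_add_pow {n : ℕ} (hn : 2 ≤ n) :
    IntegrableOn (fun v : ℝ => (1 + v ^ n)⁻¹) (Ioi 0) := by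
  refine (integrable_inv_one_add_sq.const_mul 2).integrableOn.mono'
    (by measurability) ?_
  filter_upwards [ae_restrict_mem measurableSet_Ioi] with v hv
  have hv : 0 < v := hv
  rw [Real.norm_of_nonneg (by positivity), ← one_div, ← div_eq_mul_inv,
    div_le_div_iff₀ (by positivity) (by positivity)]
  rcases le_total v 1 with h | h
  · nlinarith [pow_pos hv n]
  · nlinarith [pow_le_pow_right₀ h hn]

theorem integrableOn_sectorKernel {n : ℕ} (hn : 2 ≤ n) {x : ℝ} (hx : 0 ≤ x) :
    IntegrableOn (sectorKernel n x) (Ioi 0) := by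
  refine (integrableOn_inv_one_add_pow hn).mono' ?_ ?_
  · unfold sectorKernel
    have : Measurable fun v : ℝ => (((1 + v ^ n)⁻¹ : ℝ) : ℂ) := by fun_prop
    exact (Measurable.mul (by fun_prop) this).aestronglyMeasurable
  · filter_upwards [ae_restrict_mem measurableSet_Ioi] with v hv
    have hv : 0 < v := hv
    rw [sectorKernel, norm_mul, norm_mul, norm_sectorRoot, one_mul, Complex.norm_real,
      Real.norm_of_nonneg (by positivity)]
    exact mul_le_of_le_one_left (by positivity) (norm_exp_sector_le_one hn (by positivity))

theorem integral_exp_neg_mul_Ioi_zero {c : ℝ} (hc : 0 < c) :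
    ∫ t in Ioi (0 : ℝ), Real.exp (-c * t) = c⁻¹ := by
  rw [integral_exp_mul_Ioi (by linarith)]
  simp

theorem integral_exp_neg_mul_invDensity {n : ℕ} (hn : 2 ≤ n) {x : ℝ} (hx : 0 ≤ x) :
    ∫ t in Ioi (0 : ℝ), Real.exp (-t) * invDensity (1 / (n : ℝ)) x t =
      n / Real.pi * (∫ v in Ioi (0 : ℝ), sectorKernel n x v).im := by
  set μ : Measure ℝ := volume.restrict (Ioi (0 : ℝ))
  set F : ℝ → ℝ → ℂ := fun t v => (Real.exp (-t) : ℂ) * contourKernel n x t v with hF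
  have hFc : Continuous (Function.uncurry F) := by
    simp only [hF, Function.uncurry_def]
    have h1 : Continuous fun p : ℝ × ℝ => ((Real.exp (-p.1) : ℝ) : ℂ) := by fun_prop
    have h2 : Continuous fun p : ℝ × ℝ => contourKernel n x p.1 p.2 := by
      unfold contourKernel
      fun_prop
    exact h1.mul h2
  have hFe (t v : ℝ) : F t v = sectorRoot n * Complex.exp (-(x * v : ℝ) * sectorRoot n) *
      (Real.exp (-(1 + v ^ n) * t) : ℂ) := by
    have : Real.exp (-(1 + v ^ n) * t) = Real.exp (-t) * Real.exp (-t * v ^ n) := by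
      rw [← Real.exp_add]; ring_nf
    rw [this]
    simp only [hF, contourKernel]
    push_cast
    ring
  have hexp (v : ℝ) (hv : 0 < v) :
      Integrable (fun t => Real.exp (-(1 + v ^ n) * t)) μ :=
    integrableOn_exp_mul_Ioi (by have := pow_pos hv n; linarith) 0
  have hnorm (v : ℝ) : ∫ t, ‖F t v‖ ∂μ =
      ‖sectorRoot n * Complex.exp (-(x * v : ℝ) * sectorRoot n)‖ *
        ∫ t, Real.exp (-(1 + v ^ n) * t) ∂μ := by
    rw [← integral_const_mul]
    simp only [hFe, norm_mul, Complex.norm_real, Real.norm_eq_abs, Real.abs_exp]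
  have hFi : Integrable (Function.uncurry F) (μ.prod μ) := by
    refine (integrable_prod_iff' hFc.aestronglyMeasurable).2 ⟨?_, ?_⟩
    · filter_upwards [ae_restrict_mem measurableSet_Ioi] with v hv
      simp only [Function.uncurry_apply_pair, hFe]
      exact (hexp v hv).ofReal.const_mul _
    · refine (integrableOn_sectorKernel hn hx).norm.congr ?_
      filter_upwards [ae_restrict_mem measurableSet_Ioi] with v hv
      have hv : 0 < v := hv
      have h1 : 0 < 1 + v ^ n := by positivity
      simp only [Function.uncurry_apply_pair]
      rw [hnorm, integral_exp_neg_mul_Ioi_zero h1, sectorKernel, norm_mul, Complex.norm_real,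
        Real.norm_of_nonneg (inv_pos.2 h1).le]
  have h1 : ∫ t, Real.exp (-t) * invDensity (1 / (n : ℝ)) x t ∂μ =
      ∫ t, n / Real.pi * (∫ v, F t v ∂μ).im ∂μ := by
    refine setIntegral_congr_fun measurableSet_Ioi fun t ht => ?_
    simp only [hF]
    rw [integral_const_mul, Complex.im_ofReal_mul, invDensity_eq_contour hn x ht]
    ring
  rw [h1, integral_const_mul]
  congr 1
  have h2 := Complex.imCLM.integral_comp_comm hFi.integral_prod_left
  simp only [Complex.imCLM_apply, Function.uncurry_apply_pair] at h2
  rw [h2, integral_integral_swap hFi]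
  congr 1
  refine setIntegral_congr_fun measurableSet_Ioi fun v hv => ?_
  have h1 : 0 < 1 + v ^ n := by have := pow_pos (mem_Ioi.1 hv) n; positivity
  simp only [hFe]
  rw [integral_const_mul, integral_complex_ofReal, integral_exp_neg_mul_Ioi_zero h1, sectorKernel]

/-- At x = 0 the density is the pure power t^(-1/n)/Γ(1-1/n), so the transform at 1 is a Gamma
integral. This fixes the constant left open by the contour shift. -/
theorem integral_sectorKernel_zero_im {n : ℕ} (hn : 2 ≤ n) :
    n / Real.pi * (∫ v in Ioi (0 : ℝ), sectorKernel n 0 v).im = 1 := by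
  have hn' : (2 : ℝ) ≤ n := by exact_mod_cast hn
  have h1 : 0 < 1 - 1 / (n : ℝ) := by
    rw [sub_pos, div_lt_one (by linarith)]; linarith
  rw [← integral_exp_neg_mul_invDensity hn le_rfl]
  have h2 : ∫ t in Ioi (0 : ℝ), Real.exp (-t) * invDensity (1 / (n : ℝ)) 0 t =
      ∫ t in Ioi (0 : ℝ), 1 / Real.Gamma (1 - 1 / n) *
        (Real.exp (-t) * t ^ (1 - 1 / (n : ℝ) - 1)) := by
    refine setIntegral_congr_fun measurableSet_Ioi fun t ht => ?_
    simp only [invDensity_zero_left ht, Phi, if_pos (mem_Ioi.1 ht)]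
    ring_nf
  rw [h2, integral_const_mul, ← Real.Gamma_eq_integral h1]
  exact one_div_mul_cancel (Real.Gamma_pos_of_pos h1).ne'

/-! ### Shifting the contour to the real axis -/

/-- A zero would give exp(nζ) = 1 with n Im ζ in [0, π], which forces ζ = 0; but there the sum is n.
Hence the only singularity of 1/(1-wⁿ) in the sector is w = 1, and `dslope` removes it. -/
theorem geom_sum_ne_zero_of_sector {n : ℕ} (hn : 1 ≤ n) {ζ : ℂ} (h0 : 0 ≤ ζ.im)
    (h1 : ζ.im ≤ Real.pi / n) : ∑ k ∈ Finset.range n, Complex.exp ζ ^ k ≠ 0 := by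
  intro h
  have hn0 : (0 : ℝ) < n := by exact_mod_cast hn
  have hg := geom_sum_mul (Complex.exp ζ) n
  rw [h, zero_mul, eq_comm, sub_eq_zero, ← Complex.exp_nat_mul, Complex.exp_eq_one_iff] at hg
  obtain ⟨m, hm⟩ := hg
  have him : n * ζ.im = m * (2 * Real.pi) := by
    have := congrArg Complex.im hm
    simpa using this
  rw [le_div_iff₀ hn0, mul_comm] at h1
  have hm0 : m = 0 := by
    have hlo : (-1 : ℝ) < m := by nlinarith [Real.pi_pos, mul_nonneg hn0.le h0]
    have hhi : (m : ℝ) < 1 := by nlinarith [Real.pi_pos]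
    have hlo' : -1 < m := by exact_mod_cast hlo
    have hhi' : m < 1 := by exact_mod_cast hhi
    lia
  rw [hm0, Int.cast_zero, zero_mul, mul_eq_zero] at hm
  have hζ : ζ = 0 := hm.resolve_left (by exact_mod_cast hn0.ne')
  rw [hζ] at h
  simp at h
  lia

/-- The function `(e^{-xw} - e^{-x}) w / (1 - w^n)` at `w = e^ζ`, without its singularity. -/
noncomputable def stripFun (n : ℕ) (x : ℝ) (ζ : ℂ) : ℂ :=
  Complex.exp ζ * (-dslope (fun w : ℂ => Complex.exp (-x * w)) 1 (Complex.exp ζ)) /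
    ∑ k ∈ Finset.range n, Complex.exp ζ ^ k

theorem stripFun_eq {n : ℕ} (x : ℝ) {ζ : ℂ} (h : Complex.exp ζ ^ n ≠ 1) :
    stripFun n x ζ = Complex.exp ζ * (Complex.exp (-x * Complex.exp ζ) - Complex.exp (-x)) /
      (1 - Complex.exp ζ ^ n) := by
  have h1 : Complex.exp ζ ≠ 1 := fun h' => h (by rw [h', one_pow])
  have h2 := geom_sum_mul (Complex.exp ζ) n
  have h3 : Complex.exp ζ - 1 ≠ 0 := sub_ne_zero.2 h1
  have h4 : 1 - Complex.exp ζ ^ n ≠ 0 := sub_ne_zero.2 h.symm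
  have h5 : ∑ k ∈ Finset.range n, Complex.exp ζ ^ k ≠ 0 := by
    intro h'
    rw [h', zero_mul] at h2
    exact h4 (by linear_combination h2)
  rw [stripFun, dslope_of_ne _ h1, slope_def_field, mul_one, div_eq_div_iff h5 h4]
  generalize Complex.exp (-x * Complex.exp ζ) = a
  field_simp
  linear_combination (Complex.exp (-x) - a) * h2

theorem differentiableAt_stripFun {n : ℕ} (hn : 1 ≤ n) (x : ℝ) {ζ : ℂ} (h0 : 0 ≤ ζ.im)
    (h1 : ζ.im ≤ Real.pi / n) : DifferentiableAt ℂ (stripFun n x) ζ := by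
  have hd : Differentiable ℂ (dslope (fun w : ℂ => Complex.exp (-x * w)) 1) := by
    rw [← differentiableOn_univ, Complex.differentiableOn_dslope univ_mem]
    exact Differentiable.differentiableOn (by fun_prop)
  unfold stripFun
  have h2 : DifferentiableAt ℂ
      (fun ζ => dslope (fun w : ℂ => Complex.exp (-x * w)) 1 (Complex.exp ζ)) ζ :=
    (hd _).comp ζ Complex.differentiableAt_exp
  exact (Complex.differentiableAt_exp.mul h2.neg).div (by fun_prop)
    (geom_sum_ne_zero_of_sector hn h0 h1)

/-- The exponential numerator is at most 2 because Re w ≥ 0. The quotient |w|/|1-wⁿ| is controlled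
for small w by 1-|w|ⁿ and for large w by |w|ⁿ-1, so the vertical sides vanish in the limit. -/
theorem norm_stripFun_le {n : ℕ} (hn : 2 ≤ n) {x : ℝ} (hx : 0 ≤ x) {ζ : ℂ} (h0 : 0 ≤ ζ.im)
    (h1 : ζ.im ≤ Real.pi / n) {R : ℝ} (hR : 0 < R) (hζ : ζ.re = R ∨ ζ.re = -R) :
    ‖stripFun n x ζ‖ ≤ 2 * Real.exp (-R) / (1 - Real.exp (-R) ^ 2) := by
  have hn' : (2 : ℝ) ≤ n := by exact_mod_cast hn
  set w := Complex.exp ζ with hw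
  have hwn : ‖w‖ = Real.exp ζ.re := Complex.norm_exp ζ
  have hre : 0 ≤ w.re := by
    rw [hw, Complex.exp_re]
    have h2 : Real.pi / n ≤ Real.pi / 2 := div_le_div_of_nonneg_left Real.pi_pos.le two_pos hn'
    have := Real.cos_nonneg_of_neg_pi_div_two_le_of_le (x := ζ.im)
      (by linarith [Real.pi_pos]) (h1.trans h2)
    positivity
  have hE (u : ℂ) (hu : 0 ≤ u.re) : ‖Complex.exp (-x * u)‖ ≤ 1 := by
    rw [Complex.norm_exp, Real.exp_le_one_iff, ← Complex.ofReal_neg, Complex.re_ofReal_mul]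
    nlinarith
  have hnum : ‖Complex.exp (-x * w) - Complex.exp (-x)‖ ≤ 2 := by
    refine (norm_sub_le _ _).trans ?_
    have := hE w hre
    have h2 := hE 1 (by simp)
    rw [mul_one] at h2
    linarith
  have hp1 : Real.exp (-R) < 1 := Real.exp_lt_one_iff.2 (by linarith)
  have hp0 : 0 < Real.exp (-R) := Real.exp_pos _
  have hp2 : 0 < 1 - Real.exp (-R) ^ 2 := by nlinarith
  have hpn : Real.exp (-R) ^ n ≤ Real.exp (-R) ^ 2 := pow_le_pow_of_le_one hp0.le hp1.le hn
  have hpe : Real.exp R * Real.exp (-R) = 1 := by rw [← Real.exp_add]; simp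
  have hden : ‖w‖ * (1 - Real.exp (-R) ^ 2) ≤ Real.exp (-R) * ‖1 - w ^ n‖ := by
    rcases hζ with h | h
    · have h3 : ‖w‖ ^ n - 1 ≤ ‖1 - w ^ n‖ := by
        have := norm_sub_norm_le (w ^ n) 1
        rwa [norm_pow, norm_one, norm_sub_rev] at this
      rw [h] at hwn
      rw [hwn] at h3 ⊢
      have hR1 : 1 ≤ Real.exp R := Real.one_le_exp hR.le
      have h4 : Real.exp R ^ 2 ≤ Real.exp R ^ n := pow_le_pow_right₀ hR1 hn
      calc Real.exp R * (1 - Real.exp (-R) ^ 2)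
          = Real.exp (-R) * (Real.exp R ^ 2 - 1) := by
            linear_combination (-Real.exp (-R) - Real.exp R) * hpe
        _ ≤ Real.exp (-R) * ‖1 - w ^ n‖ := by
            refine mul_le_mul_of_nonneg_left ?_ hp0.le
            linarith
    · have h3 : 1 - ‖w‖ ^ n ≤ ‖1 - w ^ n‖ := by
        have := norm_sub_norm_le 1 (w ^ n)
        rwa [norm_pow, norm_one] at this
      rw [h] at hwn
      rw [hwn] at h3 ⊢
      refine mul_le_mul_of_nonneg_left ?_ hp0.le
      linarith
  have hw0 : 0 < ‖w‖ := hwn ▸ Real.exp_pos _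
  have hne : 0 < ‖1 - w ^ n‖ := by
    have := mul_pos hw0 hp2
    exact pos_of_mul_pos_right (this.trans_le hden) hp0.le
  have hne' : w ^ n ≠ 1 := fun h => by simp [h] at hne
  rw [stripFun_eq x hne', norm_div, norm_mul, div_le_div_iff₀ hne hp2]
  calc ‖w‖ * ‖Complex.exp (-x * w) - Complex.exp (-x)‖ * (1 - Real.exp (-R) ^ 2)
      ≤ ‖w‖ * 2 * (1 - Real.exp (-R) ^ 2) := by gcongr
    _ ≤ 2 * Real.exp (-R) * ‖1 - w ^ n‖ := by linarith

theorem integral_stripFun_real_im {n : ℕ} (hn : 1 ≤ n) (x R : ℝ) :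
    (∫ r in (-R)..R, stripFun n x r).im = 0 := by
  have h : ∫ r in (-R)..R, stripFun n x r = ∫ r in (-R)..R,
      ((Real.exp r * (Real.exp (-x * Real.exp r) - Real.exp (-x)) / (1 - Real.exp r ^ n) : ℝ) :
        ℂ) := by
    refine intervalIntegral.integral_congr_ae ?_
    have h0 : ∀ᵐ r : ℝ, r ≠ 0 := compl_mem_ae_iff.2 (measure_singleton 0)
    filter_upwards [h0] with r hr _
    have h1 : Complex.exp r ^ n ≠ 1 := by
      rw [← Complex.ofReal_exp]
      norm_cast
      rw [pow_eq_one_iff_of_nonneg (Real.exp_pos r).le (by lia), Real.exp_eq_one_iff]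
      exact hr
    rw [stripFun_eq x h1]
    push_cast
    rfl
  rw [h, intervalIntegral.integral_ofReal, Complex.ofReal_im]

/-- On the top side wⁿ = -e^{nr}, so the denominator becomes 1+vⁿ with v = e^r; the factor e^r is
the Jacobian of that substitution. -/
theorem stripFun_top {n : ℕ} (hn : 1 ≤ n) (x r : ℝ) :
    stripFun n x (r + (Real.pi / n : ℝ) * Complex.I) =
      Real.exp r • (sectorKernel n x (Real.exp r) -
        (Real.exp (-x) : ℂ) * sectorKernel n 0 (Real.exp r)) := by
  have hw : Complex.exp (r + (Real.pi / n : ℝ) * Complex.I) = Real.exp r * sectorRoot n := by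
    rw [Complex.exp_add, sectorRoot, Complex.ofReal_exp]
  have hwn : (Real.exp r * sectorRoot n) ^ n = -((Real.exp r ^ n : ℝ) : ℂ) := by
    rw [mul_pow, sectorRoot_pow n hn]
    push_cast
    ring
  have hpos : 0 < 1 + Real.exp r ^ n := by positivity
  have hne : (1 : ℂ) + (Real.exp r : ℂ) ^ n ≠ 0 := by exact_mod_cast hpos.ne'
  rw [stripFun_eq, hw, hwn]
  · simp only [sectorKernel, Complex.real_smul]
    push_cast at hne ⊢
    simp only [zero_mul, neg_zero, Complex.exp_zero, sub_neg_eq_add]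
    field_simp
  · rw [hw, hwn]
    intro h
    apply hne
    push_cast at h
    rw [← h]
    push_cast
    ring

theorem continuousOn_sectorKernel (n : ℕ) (x : ℝ) :
    ContinuousOn (sectorKernel n x) (Ioi 0) := by
  have h : ContinuousOn (fun v : ℝ => (((1 + v ^ n)⁻¹ : ℝ) : ℂ)) (Ioi 0) := by
    refine Complex.continuous_ofReal.comp_continuousOn (ContinuousOn.inv₀ (by fun_prop) ?_)
    intro v hv
    have := pow_pos (mem_Ioi.1 hv) n
    positivity
  exact ContinuousOn.mul (by fun_prop) h

/-- Under w = e^ζ the sector is the strip 0 ≤ Im ζ ≤ π/n. Apply Cauchy's theorem to rectangles in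
it: the integrand is real on the bottom side, so the imaginary part of the top integral comes only
from the vertical sides, which tend to 0. -/
theorem integral_sectorKernel_im {n : ℕ} (hn : 2 ≤ n) {x : ℝ} (hx : 0 ≤ x) :
    (∫ v in Ioi (0 : ℝ), sectorKernel n x v).im =
      Real.exp (-x) * (∫ v in Ioi (0 : ℝ), sectorKernel n 0 v).im := by
  set θ : ℝ := Real.pi / n with hθ
  have hθ0 : 0 ≤ θ := by positivity
  set H : ℝ → ℂ := fun v => sectorKernel n x v - (Real.exp (-x) : ℂ) * sectorKernel n 0 v with hH
  have hHi : IntegrableOn H (Ioi 0) := (integrableOn_sectorKernel hn hx).sub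
    ((integrableOn_sectorKernel hn le_rfl).const_mul _)
  have hHc : ContinuousOn H (Ioi 0) := (continuousOn_sectorKernel n x).sub
    (continuousOn_const.mul (continuousOn_sectorKernel n 0))
  have htop (R : ℝ) : ∫ r in (-R)..R, stripFun n x (r + θ * Complex.I) =
      ∫ v in Real.exp (-R)..Real.exp R, H v := by
    rw [← intervalIntegral.integral_deriv_smul_comp' (f := Real.exp) (f' := Real.exp) (g := H)
      (fun r _ => Real.hasDerivAt_exp r) Real.continuous_exp.continuousOn
      (hHc.mono (by rintro _ ⟨r, -, rfl⟩; exact Real.exp_pos r))]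
    simp only [hθ, stripFun_top (by lia : 1 ≤ n) x, hH, Function.comp_apply]
  have hlim : Tendsto (fun R : ℝ => ∫ v in Real.exp (-R)..Real.exp R, H v) atTop
      (𝓝 (∫ v in Ioi (0 : ℝ), H v)) := by
    have hcov : AECover (volume.restrict (Ioi (0 : ℝ))) atTop
        fun R : ℝ => Ioi (Real.exp (-R)) ∩ Iic (Real.exp R) :=
      (aecover_Ioi_of_Ioi (Real.tendsto_exp_neg_atTop_nhds_zero)).inter
        (aecover_Iic Real.tendsto_exp_atTop)
    refine (hcov.integral_tendsto_of_countably_generated hHi).congr' ?_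
    filter_upwards [eventually_ge_atTop 0] with R hR
    have hle : Real.exp (-R) ≤ Real.exp R := Real.exp_le_exp.2 (by linarith)
    rw [intervalIntegral.integral_of_le hle, Measure.restrict_restrict
      (measurableSet_Ioi.inter measurableSet_Iic), Ioi_inter_Iic, inter_eq_left.2]
    exact fun v hv => (Real.exp_pos _).trans hv.1
  set B : ℝ → ℝ := fun R => 2 * Real.exp (-R) / (1 - Real.exp (-R) ^ 2) with hB
  have hBl : Tendsto (fun R => 2 * (B R * |θ - 0|)) atTop (𝓝 0) := by
    have h := Real.tendsto_exp_neg_atTop_nhds_zero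
    have h1 : Tendsto B atTop (𝓝 (2 * 0 / (1 - 0 ^ 2))) :=
      (h.const_mul 2).div (tendsto_const_nhds.sub (h.pow 2)) (by norm_num)
    simpa using (h1.mul_const |θ - 0|).const_mul 2
  have hvert (R : ℝ) (hR : 0 < R) (ρ : ℝ) (hρ : ρ = R ∨ ρ = -R) :
      ‖∫ y in (0 : ℝ)..θ, stripFun n x (ρ + y * Complex.I)‖ ≤ B R * |θ - 0| := by
    refine intervalIntegral.norm_integral_le_of_norm_le_const fun y hy => ?_
    rw [uIoc_of_le hθ0] at hy
    exact norm_stripFun_le hn hx (by simpa using hy.1.le) (by simpa using hy.2) hR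
      (by simpa using hρ)
  have hcauchy (R : ℝ) (hR : 0 < R) :
      |(∫ v in Real.exp (-R)..Real.exp R, H v).im| ≤ 2 * (B R * |θ - 0|) := by
    have hc := Complex.integral_boundary_rect_eq_zero_of_differentiableOn (stripFun n x)
      ((-R : ℝ) : ℂ) (R + θ * Complex.I) (by
        intro ζ hζ
        refine (differentiableAt_stripFun (by lia) x ?_ ?_).differentiableWithinAt
        all_goals
          have := hζ.2
          simp [uIcc_of_le hθ0] at this
        · exact this.1
        · exact this.2)
    have e1 : ((-R : ℝ) : ℂ).re = -R := Complex.ofReal_re _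
    have e2 : ((-R : ℝ) : ℂ).im = 0 := Complex.ofReal_im _
    have e3 : ((R : ℂ) + θ * Complex.I).re = R := by simp
    have e4 : ((R : ℂ) + θ * Complex.I).im = θ := by simp
    simp only [e1, e2, e3, e4, Complex.ofReal_zero, zero_mul, add_zero, htop R] at hc
    have hre := integral_stripFun_real_im (by lia : 1 ≤ n) x R
    set V1 := ∫ y in (0 : ℝ)..θ, stripFun n x ((R : ℝ) + y * Complex.I) with hV1
    set V2 := ∫ y in (0 : ℝ)..θ, stripFun n x ((-R : ℝ) + y * Complex.I) with hV2
    have him := congrArg Complex.im hc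
    simp only [Complex.add_im, Complex.sub_im, hre, smul_eq_mul, Complex.I_mul_im,
      Complex.zero_im] at him
    have h1 := (Complex.abs_re_le_norm V1).trans (hvert R hR R (Or.inl rfl))
    have h2 := (Complex.abs_re_le_norm V2).trans (hvert R hR (-R) (Or.inr rfl))
    have h3 : (∫ v in Real.exp (-R)..Real.exp R, H v).im = V1.re - V2.re := by linarith
    rw [h3]
    exact (abs_sub _ _).trans (by linarith)
  have hz : Tendsto (fun R : ℝ => (∫ v in Real.exp (-R)..Real.exp R, H v).im) atTop (𝓝 0) := by
    refine squeeze_zero_norm' ?_ hBl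
    filter_upwards [eventually_gt_atTop 0] with R hR using hcauchy R hR
  have hfin := tendsto_nhds_unique ((Complex.continuous_im.tendsto _).comp hlim) hz
  rw [hH, integral_sub (integrableOn_sectorKernel hn hx)
    ((integrableOn_sectorKernel hn le_rfl).const_mul _), integral_const_mul, Complex.sub_im,
    Complex.im_ofReal_mul] at hfin
  linarith

theorem laplace_one_invDensity {n : ℕ} (hn : 2 ≤ n) {x : ℝ} (hx : 0 ≤ x) :
    ∫ t in Ioi (0 : ℝ), Real.exp (-t) * invDensity (1 / (n : ℝ)) x t = Real.exp (-x) := by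
  rw [integral_exp_neg_mul_invDensity hn hx, integral_sectorKernel_im hn hx]
  linear_combination Real.exp (-x) * integral_sectorKernel_zero_im hn

/-! ### Uniqueness of the Laplace transform -/

theorem integrableOn_exp_neg_mul_of_bounded {f : ℝ → ℝ} (hf : Measurable f) {C : ℝ}
    (hC : ∀ t, |f t| ≤ C) {s : ℝ} (hs : 0 < s) :
    IntegrableOn (fun t => Real.exp (-s * t) * f t) (Ioi 0) := by
  have h : IntegrableOn (fun t => Real.exp (-s * t)) (Ioi 0) :=
    integrableOn_exp_mul_Ioi (by linarith) 0
  exact h.mul_bdd (c := C) hf.aestronglyMeasurable (ae_of_all _ hC)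

/-- The measure on `(0,∞)` with density `(f + C + 1) e^{-t}`, positive when `|f| ≤ C`. -/
noncomputable def tilted (f : ℝ → ℝ) (C : ℝ) : Measure ℝ :=
  (volume.restrict (Ioi (0 : ℝ))).withDensity
    fun t => ENNReal.ofReal (Real.exp (-1 * t) * (f t + (C + 1)))

section tilted

variable {f : ℝ → ℝ} {C : ℝ}

theorem integrableOn_tilted_density (hf : Measurable f) (hC : ∀ t, |f t| ≤ C) {s : ℝ}
    (hs : 0 < s) : IntegrableOn (fun t => Real.exp (-s * t) * (f t + (C + 1))) (Ioi 0) := by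
  refine integrableOn_exp_neg_mul_of_bounded (hf.add_const _) (C := 2 * C + 1) (fun t => ?_) hs
  have h1 := hC t
  rw [abs_le] at h1 ⊢
  constructor <;> linarith

theorem isFiniteMeasure_tilted (hf : Measurable f) (hC : ∀ t, |f t| ≤ C) :
    IsFiniteMeasure (tilted f C) :=
  isFiniteMeasure_withDensity_ofReal (integrableOn_tilted_density hf hC one_pos).2

/-- The density lies between positive multiples of e^{-t}, so the integrability set does not depend
on f. This lets two moment generating functions be compared at every r, default values included. -/
theorem integrable_exp_tilted_iff (hf : Measurable f) (hC : ∀ t, |f t| ≤ C) (r : ℝ) :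
    Integrable (fun t => Real.exp (r * t)) (tilted f C) ↔ r < 1 := by
  have hpos (t : ℝ) : 1 ≤ f t + (C + 1) := by linarith [(abs_le.1 (hC t)).1]
  have hmul (t : ℝ) : Real.exp (r * t) * (Real.exp (-1 * t) * (f t + (C + 1))) =
      Real.exp (-(1 - r) * t) * (f t + (C + 1)) := by
    rw [← mul_assoc, ← Real.exp_add]; ring_nf
  have hnn (t : ℝ) : 0 ≤ Real.exp (-1 * t) * (f t + (C + 1)) :=
    mul_nonneg (Real.exp_pos _).le (zero_le_one.trans (hpos t))
  rw [tilted, integrable_withDensity_iff (by fun_prop) (ae_of_all _ fun t => ENNReal.ofReal_lt_top)]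
  simp only [ENNReal.toReal_ofReal (hnn _), hmul]
  constructor
  · intro h
    by_contra! hr
    have h1 : Integrable (fun _ : ℝ => (1 : ℝ)) (volume.restrict (Ioi (0 : ℝ))) := by
      refine h.mono' aestronglyMeasurable_const ?_
      filter_upwards [ae_restrict_mem measurableSet_Ioi] with t ht
      have h2 : 1 ≤ Real.exp (-(1 - r) * t) :=
        Real.one_le_exp (by nlinarith [mem_Ioi.1 ht])
      rw [norm_one]
      nlinarith [hpos t]
    rw [integrable_const_iff] at h1
    have := h1.resolve_left one_ne_zero
    simpa using this.measure_univ_lt_top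
  · intro hr
    exact integrableOn_tilted_density hf hC (by linarith)

theorem mgf_tilted (hf : Measurable f) (hC : ∀ t, |f t| ≤ C) {r : ℝ} (hr : r < 1) :
    mgf id (tilted f C) r = (∫ t in Ioi (0 : ℝ), Real.exp (-(1 - r) * t) * f t) +
      (1 - r)⁻¹ * (C + 1) := by
  have hpos (t : ℝ) : 1 ≤ f t + (C + 1) := by linarith [(abs_le.1 (hC t)).1]
  have hnn (t : ℝ) : 0 ≤ Real.exp (-1 * t) * (f t + (C + 1)) :=
    mul_nonneg (Real.exp_pos _).le (zero_le_one.trans (hpos t))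
  have hmul (t : ℝ) : (Real.exp (-1 * t) * (f t + (C + 1))) * Real.exp (r * t) =
      Real.exp (-(1 - r) * t) * f t + Real.exp (-(1 - r) * t) * (C + 1) := by
    rw [← mul_add, mul_right_comm, ← Real.exp_add]; ring_nf
  have hr' : 0 < 1 - r := by linarith
  rw [mgf, tilted, integral_withDensity_eq_integral_toReal_smul (by fun_prop)
    (ae_of_all _ fun t => ENNReal.ofReal_lt_top)]
  simp only [ENNReal.toReal_ofReal (hnn _), smul_eq_mul, id, hmul]
  rw [integral_add (integrableOn_exp_neg_mul_of_bounded hf hC hr')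
    ((integrableOn_exp_mul_Ioi (by linarith) 0).mul_const _), integral_mul_const,
    integral_exp_neg_mul_Ioi_zero hr']

end tilted

/-- Uniqueness of the Laplace transform for bounded measurable functions. -/
theorem ae_eq_of_laplace_eq {f g : ℝ → ℝ} {C : ℝ} (hf : Measurable f) (hg : Measurable g)
    (hfC : ∀ t, |f t| ≤ C) (hgC : ∀ t, |g t| ≤ C)
    (h : ∀ s : ℝ, 0 < s → ∫ t in Ioi (0 : ℝ), Real.exp (-s * t) * f t =
      ∫ t in Ioi (0 : ℝ), Real.exp (-s * t) * g t) :
    f =ᵐ[volume.restrict (Ioi 0)] g := by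
  have := isFiniteMeasure_tilted hf hfC
  have := isFiniteMeasure_tilted hg hgC
  have hmgf : mgf id (tilted f C) = mgf id (tilted g C) := by
    ext r
    rcases lt_or_ge r 1 with hr | hr
    · rw [mgf_tilted hf hfC hr, mgf_tilted hg hgC hr, h _ (by linarith)]
    -- For r ≥ 1 neither exponential is integrable and both integrals take the default value 0.
    · rw [mgf, mgf, integral_undef, integral_undef]
      · exact fun h' => hr.not_gt ((integrable_exp_tilted_iff hg hgC r).1 h')
      · exact fun h' => hr.not_gt ((integrable_exp_tilted_iff hf hfC r).1 h')
  have hzero : tilted f C = 0 ↔ tilted g C = 0 := by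
    have h0 := congrFun hmgf 0
    rw [mgf_zero', mgf_zero'] at h0
    rw [← Measure.measure_univ_eq_zero, ← measureReal_eq_zero_iff, h0, measureReal_eq_zero_iff,
      Measure.measure_univ_eq_zero]
  have hint : (0 : ℝ) ∈ interior (integrableExpSet id (tilted f C)) := by
    have hs : integrableExpSet id (tilted f C) = Iio 1 := by
      ext r
      exact integrable_exp_tilted_iff hf hfC r
    rw [hs, interior_Iio]
    exact zero_lt_one (α := ℝ)
  have hm : tilted f C = tilted g C := by
    -- Since 0 is interior to the integrability set, the moment generating function extends
    -- analytically to the imaginary axis and determines the characteristic function.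
    refine Measure.ext_of_charFun (funext fun t => ?_)
    rw [← complexMGF_id_mul_I, ← complexMGF_id_mul_I]
    refine eqOn_complexMGF_of_mgf' hmgf hzero ?_
    simpa using hint
  have hpos {k : ℝ → ℝ} (hk : ∀ t, |k t| ≤ C) (t : ℝ) :
      0 ≤ Real.exp (-1 * t) * (k t + (C + 1)) :=
    mul_nonneg (Real.exp_pos _).le (by linarith [(abs_le.1 (hk t)).1])
  have hd := (withDensity_eq_iff (by fun_prop) (by fun_prop) ?_).1 hm
  · filter_upwards [hd] with t ht
    rw [ENNReal.ofReal_eq_ofReal_iff (hpos hfC t) (hpos hgC t)] at ht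
    have := mul_left_cancel₀ (Real.exp_pos _).ne' ht
    linarith
  · exact (integrableOn_tilted_density hf hfC one_pos).lintegral_lt_top.ne

/-! ### Self-similarity, total mass and the initial condition -/

/-- The function `M(z) = W_{-1/n,1-1/n}(-z)`, so that `l_{1/n}(x,t) = t^{-1/n} M(x t^{-1/n})`. -/
noncomputable def wrightM (n : ℕ) (z : ℝ) : ℝ :=
  expGen (wrightCoeff n) (-z)

theorem invDensity_eq_wrightM (n : ℕ) (x t : ℝ) :
    invDensity (1 / (n : ℝ)) x t =
      t ^ (-(1 / (n : ℝ))) * wrightM n (x * t ^ (-(1 / (n : ℝ)))) := by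
  rw [invDensity_eq_expGen, wrightM, neg_mul]

theorem continuous_wrightM {n : ℕ} (hn : 2 ≤ n) : Continuous (wrightM n) :=
  (wrightCoeff_converges hn).contDiff.continuous.comp continuous_neg

theorem integrableOn_wrightM {n : ℕ} (hn : 2 ≤ n) : IntegrableOn (wrightM n) (Ioi 0) :=
  integrableOn_expGen_wrightCoeff hn

theorem measurable_invDensity {n : ℕ} (hn : 2 ≤ n) :
    Measurable fun p : ℝ × ℝ => invDensity (1 / (n : ℝ)) p.1 p.2 := by
  have := (continuous_wrightM hn).measurable
  simp only [invDensity_eq_wrightM]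
  fun_prop

theorem integrableOn_invDensity {n : ℕ} (hn : 2 ≤ n) {t : ℝ} (ht : 0 < t) :
    IntegrableOn (fun x => invDensity (1 / (n : ℝ)) x t) (Ioi 0) := by
  simp only [invDensity_eq_wrightM]
  refine Integrable.const_mul ?_ _
  have hc : 0 < t ^ (-(1 / (n : ℝ))) := Real.rpow_pos_of_pos ht _
  refine (integrableOn_Ioi_comp_mul_right_iff (wrightM n) 0 hc).2 ?_
  rw [zero_mul]
  exact integrableOn_wrightM hn

/-- The substitution z = x t^{-1/n}. Homogeneity of f in its second argument moves the prefactor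
t^{-1/n} outside, so one statement covers plain, absolute and weighted integrals. -/
theorem integral_comp_invDensity (n : ℕ) (f : ℝ → ℝ → ℝ)
    (hf : ∀ x y c, 0 < c → f x (c * y) = c * f x y) {t : ℝ} (ht : 0 < t) :
    ∫ x in Ioi (0 : ℝ), f x (invDensity (1 / (n : ℝ)) x t) =
      ∫ z in Ioi (0 : ℝ), f (z * t ^ (1 / (n : ℝ))) (wrightM n z) := by
  set c := t ^ (-(1 / (n : ℝ))) with hc
  have hc0 : 0 < c := Real.rpow_pos_of_pos ht _
  have hcc : c * t ^ (1 / (n : ℝ)) = 1 := by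
    rw [hc, ← Real.rpow_add ht, neg_add_cancel, Real.rpow_zero]
  have h := integral_comp_mul_right_Ioi
    (fun z => f (z * t ^ (1 / (n : ℝ))) (wrightM n z)) 0 hc0
  rw [zero_mul, eq_inv_smul_iff₀ hc0.ne'] at h
  rw [← h, smul_eq_mul, ← integral_const_mul]
  simp only [invDensity_eq_wrightM, ← hc, mul_assoc, hcc, mul_one, hf _ _ _ hc0]

theorem laplace_invDensity {n : ℕ} (hn : 2 ≤ n) {x : ℝ} (hx : 0 ≤ x) {s : ℝ} (hs : 0 < s) :
    ∫ t in Ioi (0 : ℝ), Real.exp (-s * t) * invDensity (1 / (n : ℝ)) x t =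
      s ^ (1 / (n : ℝ) - 1) * Real.exp (-x * s ^ (1 / (n : ℝ))) := by
  set ν : ℝ := 1 / (n : ℝ)
  have hsν : 0 < s ^ ν := Real.rpow_pos_of_pos hs _
  have h := integral_comp_mul_right_Ioi
    (fun τ => Real.exp (-τ) * invDensity ν (x * s ^ ν) τ) 0 hs
  rw [zero_mul, laplace_one_invDensity hn (by positivity), smul_eq_mul] at h
  have h2 : ∫ t in Ioi (0 : ℝ), Real.exp (-s * t) * invDensity ν x t =
      ∫ t in Ioi (0 : ℝ), s ^ ν * (Real.exp (-(t * s)) * invDensity ν (x * s ^ ν) (t * s)) := by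
    refine setIntegral_congr_fun measurableSet_Ioi fun t ht => ?_
    have ht : 0 < t := ht
    have h3 : s ^ ν * s ^ (-ν) = 1 := by
      rw [← Real.rpow_add hs, add_neg_cancel, Real.rpow_zero]
    have h4 : x * s ^ ν * (t ^ (-ν) * s ^ (-ν)) = x * t ^ (-ν) := by
      linear_combination x * t ^ (-ν) * h3
    have h5 : -(t * s) = -s * t := by ring
    simp only [ν, invDensity_eq_wrightM] at *
    rw [Real.mul_rpow ht.le hs.le, h4, h5]
    linear_combination (-Real.exp (-s * t) * t ^ (-(1 / (n : ℝ))) *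
      wrightM n (x * t ^ (-(1 / (n : ℝ))))) * h3
  rw [h2, integral_const_mul, h, Real.rpow_sub_one hs.ne', neg_mul]
  ring

theorem integrable_laplace_invDensity {n : ℕ} (hn : 2 ≤ n) {s : ℝ} (hs : 0 < s) :
    Integrable (Function.uncurry fun y t => Real.exp (-s * t) * invDensity (1 / (n : ℝ)) y t)
      ((volume.restrict (Ioi (0 : ℝ))).prod (volume.restrict (Ioi (0 : ℝ)))) := by
  have hm := measurable_invDensity hn
  have hmeas : Measurable
      (Function.uncurry fun y t => Real.exp (-s * t) * invDensity (1 / (n : ℝ)) y t) := by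
    simp only [Function.uncurry_def]
    fun_prop
  refine (integrable_prod_iff' hmeas.aestronglyMeasurable).2 ⟨?_, ?_⟩
  · filter_upwards [ae_restrict_mem measurableSet_Ioi] with t ht
    exact (integrableOn_invDensity hn ht).const_mul (Real.exp (-s * t))
  · have h : IntegrableOn (fun t => Real.exp (-s * t) * ∫ z in Ioi (0 : ℝ), |wrightM n z|)
        (Ioi 0) := (integrableOn_exp_mul_Ioi (by linarith) 0).mul_const _
    refine h.congr ?_
    filter_upwards [ae_restrict_mem measurableSet_Ioi] with t ht
    simp only [Function.uncurry_apply_pair, norm_mul, Real.norm_eq_abs, Real.abs_exp]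
    rw [integral_const_mul, integral_comp_invDensity n (fun _ y => |y|)
      (fun x y c hc => by rw [abs_mul, abs_of_pos hc]) ht]

/-- Integrate e^{-t} l(y,t) over both variables. Time first gives ∫ e^{-y} dy = 1; space first gives
the mass of M, which is the same for all t, times ∫ e^{-t} dt = 1. -/
theorem integral_wrightM {n : ℕ} (hn : 2 ≤ n) : ∫ z in Ioi (0 : ℝ), wrightM n z = 1 := by
  have h := integral_integral_swap (integrable_laplace_invDensity hn one_pos)
  have h1 : ∫ y in Ioi (0 : ℝ), ∫ t in Ioi (0 : ℝ),
      Real.exp (-1 * t) * invDensity (1 / (n : ℝ)) y t = 1 := by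
    rw [setIntegral_congr_fun (g := fun y => Real.exp (-1 * y)) measurableSet_Ioi,
      integral_exp_neg_mul_Ioi_zero one_pos, inv_one]
    intro y hy
    simp only
    rw [laplace_invDensity hn (mem_Ioi.1 hy).le one_pos]
    simp
  have h2 : ∫ t in Ioi (0 : ℝ), ∫ y in Ioi (0 : ℝ),
      Real.exp (-1 * t) * invDensity (1 / (n : ℝ)) y t = ∫ z in Ioi (0 : ℝ), wrightM n z := by
    rw [setIntegral_congr_fun (g := fun t => Real.exp (-1 * t) * ∫ z in Ioi (0 : ℝ), wrightM n z)
      measurableSet_Ioi, integral_mul_const, integral_exp_neg_mul_Ioi_zero one_pos, inv_one,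
      one_mul]
    intro t ht
    simp only
    rw [integral_const_mul, integral_comp_invDensity n (fun _ y => y) (fun _ _ _ _ => rfl) ht]
  rw [← h2, ← h, h1]

/-- After rescaling, t enters only through f(z t^{1/n}), which tends to f(0); dominated convergence
applies with the majorant C|M|. -/
theorem tendsto_integral_mul_invDensity {n : ℕ} (hn : 2 ≤ n) {f : ℝ → ℝ} (hf : Continuous f)
    {C : ℝ} (hC : ∀ x, |f x| ≤ C) :
    Tendsto (fun t => ∫ x in Ioi (0 : ℝ), f x * invDensity (1 / (n : ℝ)) x t)
      (𝓝[>] 0) (𝓝 (f 0)) := by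
  have hν : 0 < 1 / (n : ℝ) := by
    have : 0 < n := by lia
    positivity
  have h : Tendsto (fun t : ℝ => ∫ z in Ioi (0 : ℝ), f (z * t ^ (1 / (n : ℝ))) * wrightM n z)
      (𝓝[>] 0) (𝓝 (∫ z in Ioi (0 : ℝ), f 0 * wrightM n z)) := by
    refine tendsto_integral_filter_of_dominated_convergence (fun z => C * |wrightM n z|) ?_ ?_
      ((integrableOn_wrightM hn).abs.const_mul C) ?_
    · refine Eventually.of_forall fun t => Continuous.aestronglyMeasurable ?_
      have := continuous_wrightM hn
      fun_prop
    · refine Eventually.of_forall fun t => ae_of_all _ fun z => ?_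
      rw [norm_mul]
      exact mul_le_mul_of_nonneg_right (hC _) (norm_nonneg _)
    · refine ae_of_all _ fun z => Tendsto.mul_const _ ?_
      have h1 : Tendsto (fun t : ℝ => z * t ^ (1 / (n : ℝ))) (𝓝[>] 0) (𝓝 0) := by
        have h2 : ContinuousAt (fun t : ℝ => z * t ^ (1 / (n : ℝ))) 0 :=
          continuousAt_const.mul (Real.continuousAt_rpow_const 0 _ (Or.inr hν.le))
        have h3 := h2.tendsto
        rw [Real.zero_rpow hν.ne', mul_zero] at h3
        exact h3.mono_left nhdsWithin_le_nhds
      exact (hf.tendsto 0).comp h1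
  rw [integral_const_mul, integral_wrightM hn, mul_one] at h
  refine h.congr' ?_
  filter_upwards [self_mem_nhdsWithin] with t ht
  exact (integral_comp_invDensity n (fun x y => f x * y) (fun x y c _ => by ring) ht).symm

/-! ### The distribution function and its transform -/

/-- The distribution function of the law with density `wrightM n` on `(0,∞)`. -/
noncomputable def wrightCdf (n : ℕ) (z : ℝ) : ℝ :=
  ∫ u in (0 : ℝ)..z, wrightM n u

theorem hasDerivAt_wrightCdf {n : ℕ} (hn : 2 ≤ n) (z : ℝ) :
    HasDerivAt (wrightCdf n) (wrightM n z) z :=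
  intervalIntegral.integral_hasDerivAt_right ((continuous_wrightM hn).intervalIntegrable _ _)
    ((continuous_wrightM hn).stronglyMeasurableAtFilter _ _) (continuous_wrightM hn).continuousAt

theorem continuous_wrightCdf {n : ℕ} (hn : 2 ≤ n) : Continuous (wrightCdf n) :=
  continuous_iff_continuousAt.2 fun z => (hasDerivAt_wrightCdf hn z).continuousAt

theorem tendsto_wrightCdf {n : ℕ} (hn : 2 ≤ n) : Tendsto (wrightCdf n) atTop (𝓝 1) := by
  rw [← integral_wrightM hn]
  exact intervalIntegral_tendsto_integral_Ioi 0 (integrableOn_wrightM hn) tendsto_id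

theorem abs_wrightCdf_le {n : ℕ} (hn : 2 ≤ n) {z : ℝ} (hz : 0 ≤ z) :
    |wrightCdf n z| ≤ ∫ u in Ioi (0 : ℝ), |wrightM n u| := by
  rw [wrightCdf, intervalIntegral.integral_of_le hz]
  refine (abs_integral_le_integral_abs).trans ?_
  exact setIntegral_mono_set (integrableOn_wrightM hn).abs (ae_of_all _ fun _ => abs_nonneg _)
    Ioc_subset_Ioi_self.eventuallyLE

theorem integral_invDensity_eq_wrightCdf (n : ℕ) (x : ℝ) {t : ℝ} (ht : 0 < t) :
    ∫ y in (0 : ℝ)..x, invDensity (1 / (n : ℝ)) y t = wrightCdf n (x * t ^ (-(1 / (n : ℝ)))) := by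
  have hc0 : 0 < t ^ (-(1 / (n : ℝ))) := Real.rpow_pos_of_pos ht _
  simp only [invDensity_eq_wrightM]
  rw [intervalIntegral.integral_const_mul,
    intervalIntegral.integral_comp_mul_right (wrightM n) hc0.ne', zero_mul, smul_eq_mul,
    mul_inv_cancel_left₀ hc0.ne', wrightCdf]

theorem laplace_wrightCdf {n : ℕ} (hn : 2 ≤ n) {x : ℝ} (hx : 0 ≤ x) {s : ℝ} (hs : 0 < s) :
    ∫ t in Ioi (0 : ℝ), Real.exp (-s * t) * wrightCdf n (x * t ^ (-(1 / (n : ℝ)))) =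
      s⁻¹ * (1 - Real.exp (-x * s ^ (1 / (n : ℝ)))) := by
  set ν : ℝ := 1 / (n : ℝ) with hν
  have hint : Integrable (Function.uncurry fun y t => Real.exp (-s * t) * invDensity ν y t)
      ((volume.restrict (uIoc 0 x)).prod (volume.restrict (Ioi (0 : ℝ)))) := by
    have h := integrable_laplace_invDensity hn hs
    rw [Measure.prod_restrict] at h ⊢
    refine h.mono_measure (Measure.restrict_mono (prod_mono_left ?_) le_rfl)
    rw [uIoc_of_le hx]
    exact Ioc_subset_Ioi_self
  have hsw := intervalIntegral_integral_swap hint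
  have h1 : ∫ t in Ioi (0 : ℝ), Real.exp (-s * t) * wrightCdf n (x * t ^ (-ν)) =
      ∫ t in Ioi (0 : ℝ), ∫ y in (0 : ℝ)..x, Real.exp (-s * t) * invDensity ν y t := by
    refine setIntegral_congr_fun measurableSet_Ioi fun t ht => ?_
    rw [intervalIntegral.integral_const_mul, hν, integral_invDensity_eq_wrightCdf n x ht]
  have h2 : ∫ y in (0 : ℝ)..x, ∫ t in Ioi (0 : ℝ), Real.exp (-s * t) * invDensity ν y t =
      ∫ y in (0 : ℝ)..x, s ^ (ν - 1) * Real.exp (-y * s ^ ν) := by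
    refine intervalIntegral.integral_congr fun y hy => ?_
    rw [uIcc_of_le hx] at hy
    exact laplace_invDensity hn hy.1 hs
  have hd (y : ℝ) : HasDerivAt (fun y => -(s⁻¹ * Real.exp (-y * s ^ ν)))
      (s ^ (ν - 1) * Real.exp (-y * s ^ ν)) y := by
    refine ((((hasDerivAt_id y).neg.mul_const (s ^ ν)).exp).const_mul s⁻¹).neg.congr_deriv ?_
    rw [Real.rpow_sub_one hs.ne']
    simp
    ring
  rw [h1, ← hsw, h2, intervalIntegral.integral_eq_sub_of_hasDerivAt (fun y _ => hd y)
    (Continuous.intervalIntegrable (by fun_prop) _ _)]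
  simp
  ring

/-- Agreement holds on a dense set; points of it just left and right of t squeeze f(t) by
monotonicity, and continuity of g closes the gap. -/
theorem eqOn_of_antitone_of_ae_eq {f g : ℝ → ℝ} (hf : Antitone f)
    (hg : ContinuousOn g (Ioi 0)) (h : f =ᵐ[volume.restrict (Ioi 0)] g) : EqOn f g (Ioi 0) := by
  have hd : Dense {t : ℝ | 0 < t → f t = g t} :=
    Measure.dense_of_ae ((ae_restrict_iff' measurableSet_Ioi).1 h)
  intro t ht
  have ht : 0 < t := ht
  have hgt : ContinuousAt g t := hg.continuousAt (Ioi_mem_nhds ht)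
  refine eq_of_forall_dist_le fun ε hε => ?_
  obtain ⟨δ, hδ, hgδ⟩ := Metric.continuousAt_iff.1 hgt ε hε
  obtain ⟨a, ha, ha1, ha2⟩ := hd.exists_between (show max 0 (t - δ) < t from
    max_lt ht (by linarith))
  obtain ⟨b, hb, hb1, hb2⟩ := hd.exists_between (show t < t + δ by linarith)
  have ha0 : 0 < a := (le_max_left _ _).trans_lt ha1
  have ha3 : t - δ < a := (le_max_right _ _).trans_lt ha1
  have e1 := hgδ (x := a) (by rw [Real.dist_eq, abs_lt]; constructor <;> linarith)
  have e2 := hgδ (x := b) (by rw [Real.dist_eq, abs_lt]; constructor <;> linarith)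
  rw [Real.dist_eq, abs_lt] at e1 e2
  rw [Real.dist_eq, abs_le]
  have f1 := hf ha2.le
  have f2 := hf hb1.le
  rw [ha ha0] at f1
  rw [hb (ht.trans hb1)] at f2
  constructor <;> linarith

theorem setIntegral_exp_neg_indicator {s h : ℝ} (hs : 0 < s) (hh : 0 ≤ h) :
    ∫ t in Ioi (0 : ℝ), (Iio h).indicator (fun t => Real.exp (-s * t)) t =
      s⁻¹ * (1 - Real.exp (-s * h)) := by
  have hd (t : ℝ) : HasDerivAt (fun t => -(s⁻¹ * Real.exp (-s * t))) (Real.exp (-s * t)) t := by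
    refine ((((hasDerivAt_id t).const_mul (-s)).exp).const_mul s⁻¹).neg.congr_deriv ?_
    simp
    field_simp
  rw [setIntegral_indicator measurableSet_Iio, Ioi_inter_Iio, ← integral_Ioc_eq_integral_Ioo,
    ← intervalIntegral.integral_of_le hh,
    intervalIntegral.integral_eq_sub_of_hasDerivAt (fun t _ => hd t)
      (Continuous.intervalIntegrable (by fun_prop) _ _)]
  simp
  ring

/-! ### The law of the inverse process for n ≥ 2 -/

section InverseProcess

variable {Ω : Type*} {H : ℝ≥0 → Ω → ℝ}

theorem inverseProcess_le {t : ℝ} {ω : Ω} {x : ℝ≥0} (h : t < H x ω) :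
    inverseProcess H t ω ≤ x :=
  NNReal.coe_le_coe.2 (csInf_le (OrderBot.bddBelow _) h)

/-- Nonemptiness matters: the infimum of the empty set in `ℝ≥0` is 0, so a path that never exceeds t
would have inverse 0 instead of ∞. -/
theorem exists_lt_of_inverseProcess_lt {t : ℝ} {ω : Ω} (hne : ∃ x, t < H x ω) {y : ℝ}
    (h : inverseProcess H t ω < y) : ∃ x : ℝ≥0, (x : ℝ) < y ∧ t < H x ω := by
  have hy : 0 < y := (NNReal.coe_nonneg _).trans_lt h
  lift y to ℝ≥0 using hy.le
  obtain ⟨x, hx, hxy⟩ := exists_lt_of_csInf_lt hne (NNReal.coe_lt_coe.1 h)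
  exact ⟨x, NNReal.coe_lt_coe.2 hxy, hx⟩

variable [MeasurableSpace Ω] {P : Measure Ω}

/-- On monotone paths that pass t, {L < y} is the union of the events {H q > t} over rationals 0 ≤ q
< y. The equality holds only almost surely, hence null-measurability. -/
theorem aemeasurable_inverseProcess (hm : ∀ x, Measurable (H x))
    (hmono : ∀ᵐ ω ∂P, Monotone fun x => H x ω) {t : ℝ} (hne : ∀ᵐ ω ∂P, ∃ x, t < H x ω) :
    AEMeasurable (inverseProcess H t) P := by
  refine NullMeasurable.aemeasurable ?_
  have h : @Measurable (NullMeasurableSpace Ω P) ℝ _ _ (inverseProcess H t) := by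
    refine measurable_of_Iio fun y => ?_
    have hs : MeasurableSet (⋃ q : {q : ℚ // (0 : ℝ) ≤ q ∧ (q : ℝ) < y},
        {ω | t < H ⟨(q.1 : ℝ), q.2.1⟩ ω}) :=
      MeasurableSet.iUnion fun q => measurableSet_lt measurable_const (hm _)
    refine NullMeasurableSet.congr hs.nullMeasurableSet ?_
    filter_upwards [hmono, hne] with ω h1 h2
    refine propext ⟨fun h => ?_, fun h => ?_⟩
    · obtain ⟨q, hq⟩ := mem_iUnion.1 h
      exact (inverseProcess_le hq).trans_lt q.2.2
    · obtain ⟨x, hx, hxt⟩ := exists_lt_of_inverseProcess_lt h2 h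
      obtain ⟨q, hq1, hq2⟩ := exists_rat_btwn hx
      have hq0 : (0 : ℝ) ≤ q := x.coe_nonneg.trans hq1.le
      refine mem_iUnion.2 ⟨⟨q, hq0, hq2⟩, hxt.trans_le (h1 ?_)⟩
      exact NNReal.coe_le_coe.1 hq1.le
  exact h

theorem IsStableSubordinator.ae_nonneg {ν : ℝ} (hH : IsStableSubordinator ν H P) :
    ∀ᵐ ω ∂P, ∀ x, 0 ≤ H x ω := by
  filter_upwards [hH.zero, hH.mono] with ω h0 hm x
  rw [← h0]
  exact hm zero_le

variable [IsProbabilityMeasure P]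

/-- By Fubini the left side is the expectation of ∫ e^{-st} dt over 0 < t < H x, which is (1 - e^{-s
H x})/s. -/
theorem IsStableSubordinator.laplace_tail {ν : ℝ} (hH : IsStableSubordinator ν H P) (x : ℝ≥0)
    {s : ℝ} (hs : 0 < s) :
    ∫ t in Ioi (0 : ℝ), Real.exp (-s * t) * P.real {ω | t < H x ω} =
      s⁻¹ * (1 - Real.exp (-x * s ^ ν)) := by
  have hm := hH.measurable x
  set F : ℝ → Ω → ℝ := fun t ω => {ω | t < H x ω}.indicator (fun _ => Real.exp (-s * t)) ω with hF
  have hFm : Measurable (Function.uncurry F) := by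
    have hset : MeasurableSet {p : ℝ × Ω | p.1 < H x p.2} :=
      measurableSet_lt measurable_fst (hm.comp measurable_snd)
    have : Measurable ({p : ℝ × Ω | p.1 < H x p.2}.indicator fun p => Real.exp (-s * p.1)) :=
      Measurable.indicator (by fun_prop) hset
    exact this
  have hexp : Integrable (fun t => Real.exp (-s * t)) (volume.restrict (Ioi (0 : ℝ))) :=
    integrableOn_exp_mul_Ioi (by linarith) 0
  have hFi : Integrable (Function.uncurry F) ((volume.restrict (Ioi (0 : ℝ))).prod P) := by
    refine (hexp.comp_fst P).mono' hFm.aestronglyMeasurable (ae_of_all _ fun p => ?_)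
    refine (norm_indicator_le_norm_self (fun _ => Real.exp (-s * p.1)) p.2).trans ?_
    rw [Real.norm_eq_abs, Real.abs_exp]
  have hsw := integral_integral_swap hFi
  have h1 (t : ℝ) : ∫ ω, F t ω ∂P = Real.exp (-s * t) * P.real {ω | t < H x ω} := by
    simp only [hF]
    rw [integral_indicator (measurableSet_lt measurable_const hm), setIntegral_const, smul_eq_mul,
      mul_comm]
  have h2 : ∫ ω, (∫ t in Ioi (0 : ℝ), F t ω) ∂P = ∫ ω, s⁻¹ * (1 - Real.exp (-s * H x ω)) ∂P := by
    refine integral_congr_ae ?_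
    filter_upwards [hH.ae_nonneg] with ω hω
    exact setIntegral_exp_neg_indicator hs (hω x)
  have h3 : Integrable (fun ω => Real.exp (-s * H x ω)) P := by
    by_contra h
    have := hH.laplace x s hs.le
    rw [integral_undef h] at this
    exact (Real.exp_pos _).ne this
  simp only [h1] at hsw
  rw [hsw, h2, integral_const_mul, integral_sub (integrable_const _) h3, hH.laplace x s hs.le]
  simp

variable {n : ℕ}

theorem IsStableSubordinator.measureReal_lt_eq (hn : 2 ≤ n)
    (hH : IsStableSubordinator (1 / (n : ℝ)) H P) (x : ℝ≥0) {t : ℝ} (ht : 0 < t) :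
    P.real {ω | t < H x ω} = wrightCdf n (x * t ^ (-(1 / (n : ℝ)))) := by
  set f : ℝ → ℝ := fun t => P.real {ω | t < H x ω}
  -- The absolute value keeps the argument nonnegative for negative t, so that g is bounded on the
  -- whole line as `ae_eq_of_laplace_eq` requires.
  set g : ℝ → ℝ := fun t => wrightCdf n (x * |t| ^ (-(1 / (n : ℝ)))) with hg
  have hf : Antitone f := fun a b hab => measureReal_mono fun ω hω => hab.trans_lt hω
  have hgm : Measurable g := by
    have := (continuous_wrightCdf hn).measurable
    fun_prop
  have hgc : ContinuousOn g (Ioi 0) := by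
    refine (continuous_wrightCdf hn).comp_continuousOn (continuousOn_const.mul ?_)
    refine ContinuousOn.rpow_const (by fun_prop) fun t ht => Or.inl ?_
    exact abs_ne_zero.2 (mem_Ioi.1 ht).ne'
  set C : ℝ := max 1 (∫ u in Ioi (0 : ℝ), |wrightM n u|)
  have hae : f =ᵐ[volume.restrict (Ioi 0)] g := by
    refine ae_eq_of_laplace_eq (C := C) hf.measurable hgm (fun t => ?_) (fun t => ?_)
      fun s hs => ?_
    · rw [abs_of_nonneg measureReal_nonneg]
      exact measureReal_le_one.trans (le_max_left _ _)
    · exact (abs_wrightCdf_le hn (by positivity)).trans (le_max_right _ _)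
    · rw [hH.laplace_tail x hs, ← laplace_wrightCdf hn x.coe_nonneg hs]
      refine setIntegral_congr_fun measurableSet_Ioi fun t ht => ?_
      simp only [hg, abs_of_pos (mem_Ioi.1 ht)]
  have := eqOn_of_antitone_of_ae_eq hf hgc hae ht
  simpa only [hg, abs_of_pos ht] using this

/-- At t = 1 the primitive of M is y ↦ P(H y > 1), nondecreasing because paths are; its derivative M
is therefore nonnegative. -/
theorem IsStableSubordinator.wrightM_nonneg (hn : 2 ≤ n)
    (hH : IsStableSubordinator (1 / (n : ℝ)) H P) {z : ℝ} (hz : 0 < z) : 0 ≤ wrightM n z := by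
  have hmono : MonotoneOn (wrightCdf n) (Ioi 0) := by
    intro a ha b hb hab
    have h (y : ℝ) (hy : 0 < y) : wrightCdf n y = P.real {ω | 1 < H y.toNNReal ω} := by
      rw [hH.measureReal_lt_eq hn _ one_pos, Real.coe_toNNReal y hy.le]
      simp
    rw [h a ha, h b hb]
    refine ENNReal.toReal_mono (measure_ne_top _ _) (measure_mono_ae ?_)
    filter_upwards [hH.mono] with ω hω h1
    exact lt_of_lt_of_le h1 (hω (Real.toNNReal_le_toNNReal hab))
  rw [← (hasDerivAt_wrightCdf hn z).deriv, ← derivWithin_of_isOpen isOpen_Ioi hz]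
  exact hmono.derivWithin_nonneg

theorem IsStableSubordinator.invDensity_nonneg (hn : 2 ≤ n)
    (hH : IsStableSubordinator (1 / (n : ℝ)) H P) {x t : ℝ} (hx : 0 < x) (ht : 0 < t) :
    0 ≤ invDensity (1 / (n : ℝ)) x t := by
  have hc : 0 < t ^ (-(1 / (n : ℝ))) := Real.rpow_pos_of_pos ht _
  rw [invDensity_eq_wrightM]
  exact mul_nonneg hc.le (hH.wrightM_nonneg hn (mul_pos hx hc))

/-- P(H k > t) tends to 1 as k → ∞, because M has total mass 1. -/
theorem IsStableSubordinator.ae_exists_lt (hn : 2 ≤ n)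
    (hH : IsStableSubordinator (1 / (n : ℝ)) H P) {t : ℝ} (ht : 0 < t) :
    ∀ᵐ ω ∂P, ∃ x, t < H x ω := by
  have hc : 0 < t ^ (-(1 / (n : ℝ))) := Real.rpow_pos_of_pos ht _
  have hlim : Tendsto (fun k : ℕ => 1 - wrightCdf n ((k : ℝ≥0) * t ^ (-(1 / (n : ℝ))))) atTop
      (𝓝 (1 - 1)) := by
    refine tendsto_const_nhds.sub ((tendsto_wrightCdf hn).comp ?_)
    simpa using tendsto_natCast_atTop_atTop.atTop_mul_const hc
  rw [sub_self] at hlim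
  have hle (k : ℕ) : P.real {ω | ¬ ∃ x, t < H x ω} ≤
      1 - wrightCdf n ((k : ℝ≥0) * t ^ (-(1 / (n : ℝ)))) := by
    rw [← hH.measureReal_lt_eq hn k ht,
      ← probReal_compl_eq_one_sub (measurableSet_lt measurable_const (hH.measurable _))]
    exact measureReal_mono fun ω hω h => hω ⟨_, h⟩
  have h0 : P.real {ω | ¬ ∃ x, t < H x ω} = 0 :=
    le_antisymm (ge_of_tendsto' hlim hle) measureReal_nonneg
  rwa [measureReal_eq_zero_iff] at h0

/-- Up to null sets, {H y > t} ⊆ {L t ≤ y} ⊆ {H x > t} for every x > y. The outer probabilities are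
values of one continuous function, so x ↓ y gives equality. -/
theorem IsStableSubordinator.measureReal_inverseProcess_le (hn : 2 ≤ n)
    (hH : IsStableSubordinator (1 / (n : ℝ)) H P) {t : ℝ} (ht : 0 < t) {y : ℝ} (hy : 0 ≤ y) :
    P.real {ω | inverseProcess H t ω ≤ y} = wrightCdf n (y * t ^ (-(1 / (n : ℝ)))) := by
  refine le_antisymm ?_ ?_
  · have hlim : Tendsto (fun x => wrightCdf n (x * t ^ (-(1 / (n : ℝ))))) (𝓝[>] y)
        (𝓝 (wrightCdf n (y * t ^ (-(1 / (n : ℝ)))))) := by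
      have := continuous_wrightCdf hn
      have h : Continuous fun x => wrightCdf n (x * t ^ (-(1 / (n : ℝ)))) := by fun_prop
      exact h.continuousWithinAt
    refine ge_of_tendsto hlim ?_
    filter_upwards [self_mem_nhdsWithin] with x hx
    have hx : y < x := hx
    lift x to ℝ≥0 using hy.trans hx.le
    rw [← hH.measureReal_lt_eq hn x ht]
    refine ENNReal.toReal_mono (measure_ne_top _ _) (measure_mono_ae ?_)
    filter_upwards [hH.mono, hH.ae_exists_lt hn ht] with ω h1 h2 h3
    obtain ⟨z, hz, hzt⟩ := exists_lt_of_inverseProcess_lt h2 (lt_of_le_of_lt h3 hx)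
    exact lt_of_lt_of_le hzt (h1 (NNReal.coe_le_coe.1 hz.le))
  · lift y to ℝ≥0 using hy
    rw [← hH.measureReal_lt_eq hn y ht]
    exact measureReal_mono fun ω hω => inverseProcess_le hω

theorem IsStableSubordinator.map_inverseProcess (hn : 2 ≤ n)
    (hH : IsStableSubordinator (1 / (n : ℝ)) H P) {t : ℝ} (ht : 0 < t) :
    P.map (inverseProcess H t) = (volume.restrict (Ioi (0 : ℝ))).withDensity
      fun x => ENNReal.ofReal (invDensity (1 / (n : ℝ)) x t) := by
  have hmeas := aemeasurable_inverseProcess hH.measurable hH.mono (hH.ae_exists_lt hn ht)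
  have := Measure.isProbabilityMeasure_map hmeas
  refine Measure.ext_of_Iic _ _ fun y => ?_
  rw [Measure.map_apply_of_aemeasurable hmeas measurableSet_Iic,
    withDensity_apply _ measurableSet_Iic, Measure.restrict_restrict measurableSet_Iic, inter_comm,
    Ioi_inter_Iic]
  rcases lt_or_ge y 0 with hy | hy
  · have h1 : inverseProcess H t ⁻¹' Iic y = ∅ := by
      ext ω
      have h2 : 0 ≤ inverseProcess H t ω := NNReal.coe_nonneg _
      simpa using hy.trans_le h2
    rw [h1, Ioc_eq_empty hy.not_gt]
    simp
  · have hi := (integrableOn_invDensity hn ht).mono_set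
      (Ioc_subset_Ioi_self : Ioc 0 y ⊆ Ioi 0)
    rw [← ofReal_integral_eq_lintegral_ofReal hi, ← intervalIntegral.integral_of_le hy,
      integral_invDensity_eq_wrightCdf n y ht, ← hH.measureReal_inverseProcess_le hn ht hy,
      ofReal_measureReal]
    · rfl
    · filter_upwards [ae_restrict_mem measurableSet_Ioc] with x hx
      exact hH.invDensity_nonneg hn hx.1 ht

end InverseProcess

/-! ### Order one -/

section OrderOne

variable {Ω : Type*} [MeasurableSpace Ω] {P : Measure Ω} [IsProbabilityMeasure P]
  {H : ℝ≥0 → Ω → ℝ}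

/-- The variable exp(-(H x - x)) has mean 1 by the transform at s = 1 and second moment 1 by the
transform at s = 2, so its variance is 0. -/
theorem IsStableSubordinator.ae_eq_of_one (hH : IsStableSubordinator 1 H P) (x : ℝ≥0) :
    ∀ᵐ ω ∂P, H x ω = x := by
  have hl (s : ℝ) (hs : 0 ≤ s) : Integrable (fun ω => Real.exp (-s * (H x ω - x))) P ∧
      ∫ ω, Real.exp (-s * (H x ω - x)) ∂P = 1 := by
    have h := hH.laplace x s hs
    have hi : Integrable (fun ω => Real.exp (-s * H x ω)) P := by
      by_contra h'
      rw [integral_undef h'] at h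
      exact (Real.exp_pos _).ne h
    have he (ω : Ω) : Real.exp (-s * (H x ω - x)) = Real.exp (s * x) * Real.exp (-s * H x ω) := by
      rw [← Real.exp_add]; ring_nf
    simp only [he]
    refine ⟨hi.const_mul _, ?_⟩
    rw [integral_const_mul, h, Real.rpow_one, ← Real.exp_add]
    simp [mul_comm]
  obtain ⟨i1, e1⟩ := hl 1 zero_le_one
  obtain ⟨i2, e2⟩ := hl 2 zero_le_two
  have hsq (ω : Ω) : (Real.exp (-1 * (H x ω - x)) - 1) ^ 2 =
      Real.exp (-2 * (H x ω - x)) - 2 * Real.exp (-1 * (H x ω - x)) + 1 := by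
    have : Real.exp (-2 * (H x ω - x)) = Real.exp (-1 * (H x ω - x)) ^ 2 := by
      rw [← Real.exp_nat_mul]; push_cast; ring_nf
    rw [this]
    ring
  have i3 : Integrable
      (fun ω => Real.exp (-2 * (H x ω - x)) - 2 * Real.exp (-1 * (H x ω - x))) P :=
    i2.sub (i1.const_mul 2)
  have hi : Integrable (fun ω => (Real.exp (-1 * (H x ω - x)) - 1) ^ 2) P := by
    simp only [hsq]
    exact i3.add (integrable_const 1)
  have h0 : ∫ ω, (Real.exp (-1 * (H x ω - x)) - 1) ^ 2 ∂P = 0 := by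
    simp only [hsq]
    rw [integral_add i3 (integrable_const 1), integral_sub i2 (i1.const_mul 2),
      integral_const_mul, e1, e2]
    norm_num
  rw [integral_eq_zero_iff_of_nonneg (fun ω => sq_nonneg _) hi] at h0
  filter_upwards [h0] with ω hω
  have h1 : Real.exp (-1 * (H x ω - x)) - 1 = 0 := by simpa using hω
  rw [sub_eq_zero, Real.exp_eq_one_iff] at h1
  linarith

theorem IsStableSubordinator.ae_inverseProcess_eq_of_one (hH : IsStableSubordinator 1 H P)
    {t : ℝ} (ht : 0 < t) : ∀ᵐ ω ∂P, inverseProcess H t ω = t := by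
  -- The exceptional null set depends on the time; rational times give a single null set, and
  -- monotone paths fill in the rest.
  have hq : ∀ᵐ ω ∂P, ∀ q : ℚ, H (q : ℝ).toNNReal ω = (q : ℝ).toNNReal :=
    ae_all_iff.2 fun q => hH.ae_eq_of_one _
  filter_upwards [hq, hH.mono] with ω h1 h2
  refine le_antisymm ?_ ?_
  · refine le_of_forall_gt fun y hy => ?_
    obtain ⟨q, hq1, hq2⟩ := exists_rat_btwn hy
    have hq0 : ((q : ℝ).toNNReal : ℝ) = q := Real.coe_toNNReal _ (ht.trans hq1).le
    have h3 := inverseProcess_le (H := H) (t := t) (ω := ω) (x := (q : ℝ).toNNReal)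
      (by rw [h1, hq0]; exact hq1)
    rw [hq0] at h3
    exact h3.trans_lt hq2
  · by_contra! hlt
    obtain ⟨q₀, hq₀⟩ := exists_rat_gt t
    have hne : ∃ x, t < H x ω :=
      ⟨(q₀ : ℝ).toNNReal, by rw [h1, Real.coe_toNNReal _ (ht.trans hq₀).le]; exact hq₀⟩
    obtain ⟨x, hx, hxt⟩ := exists_lt_of_inverseProcess_lt hne hlt
    obtain ⟨q, hq1, hq2⟩ := exists_rat_btwn hx
    have hq0 : ((q : ℝ).toNNReal : ℝ) = q := Real.coe_toNNReal _ (x.coe_nonneg.trans hq1.le)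
    have h3 : H x ω ≤ H (q : ℝ).toNNReal ω := h2 (by
      rw [← NNReal.coe_le_coe, hq0]
      exact hq1.le)
    rw [h1, hq0] at h3
    linarith

theorem IsStableSubordinator.map_inverseProcess_of_one (hH : IsStableSubordinator 1 H P)
    {t : ℝ} (ht : 0 < t) : AEMeasurable (inverseProcess H t) P ∧
      P.map (inverseProcess H t) = Measure.dirac t := by
  have h : inverseProcess H t =ᵐ[P] fun _ => t := hH.ae_inverseProcess_eq_of_one ht
  refine ⟨aemeasurable_const.congr h.symm, ?_⟩
  rw [Measure.map_congr h, Measure.map_const, measure_univ, one_smul]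

end OrderOne

/-- Against unit masses on the diagonal, the adjoint operator becomes the derivative of t ↦ φ(t,t).
This function has compact support and vanishes at 0, so its derivative integrates to 0. -/
theorem solvesInDistributions_one_of_eq_dirac {m : ℝ → Measure ℝ}
    (hm : ∀ t, 0 < t → m t = Measure.dirac t) : SolvesInDistributions 1 m := by
  intro φ hφ hc hsupp
  have hd (p : ℝ × ℝ) : HasFDerivAt φ (fderiv ℝ φ p) p :=
    (hφ.differentiable (by simp) p).hasFDerivAt
  set ψ : ℝ → ℝ := fun t => φ (t, t) with hψ
  have hψd : ContDiff ℝ 1 ψ :=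
    (hφ.of_le (by exact_mod_cast le_top)).comp (contDiff_id.prodMk contDiff_id)
  have hψc : HasCompactSupport ψ := by
    refine HasCompactSupport.intro (hc.isCompact.image continuous_fst) fun t ht => ?_
    by_contra h
    exact ht ⟨(t, t), subset_tsupport _ h, rfl⟩
  have h0 : ψ 0 = 0 := by
    by_contra h
    exact lt_irrefl (0 : ℝ) (hsupp (subset_tsupport _ h)).1
  have hderiv (t : ℝ) : deriv (fun s => φ (t, s)) t + iteratedDeriv 1 (fun y => φ (y, t)) t =
      deriv ψ t := by
    have h1 : HasDerivAt (fun s => φ (t, s)) (fderiv ℝ φ (t, t) (0, 1)) t :=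
      (hd (t, t)).comp_hasDerivAt (f := fun s => (t, s)) t
        ((hasDerivAt_const t t).prodMk (hasDerivAt_id t))
    have h2 : HasDerivAt (fun y => φ (y, t)) (fderiv ℝ φ (t, t) (1, 0)) t :=
      (hd (t, t)).comp_hasDerivAt (f := fun y => (y, t)) t
        ((hasDerivAt_id t).prodMk (hasDerivAt_const t t))
    have h3 : HasDerivAt ψ (fderiv ℝ φ (t, t) (1, 1)) t :=
      (hd (t, t)).comp_hasDerivAt (f := fun s => (s, s)) t
        ((hasDerivAt_id t).prodMk (hasDerivAt_id t))
    rw [iteratedDeriv_one, h1.deriv, h2.deriv, h3.deriv, ← map_add]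
    simp
  have hint : ∫ t in Ioi (0 : ℝ), (∫ x, (deriv (fun s => φ (x, s)) t +
      iteratedDeriv 1 (fun y => φ (y, t)) x) ∂(m t)) = ∫ t in Ioi (0 : ℝ), deriv ψ t := by
    refine setIntegral_congr_fun measurableSet_Ioi fun t ht => ?_
    simp only [hm t ht, integral_dirac, hderiv]
  rw [hint, hψc.integral_Ioi_deriv_eq hψd 0, h0, neg_zero]

end InverseStable

theorem mainTheorem3 (n : ℕ) (hn : 1 ≤ n) :
    -- order at least two: the law has the density `l_{1/n}`, which is a classical solution
    (2 ≤ n →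
      -- `l_{1/n}(·,t)` is the density of the law of the inverse `1/n`-stable subordinator
      (∀ (Ω : Type*) [MeasurableSpace Ω] (P : Measure Ω) [IsProbabilityMeasure P]
          (H : ℝ≥0 → Ω → ℝ), InverseStable.IsStableSubordinator (1 / (n : ℝ)) H P →
          ∀ t : ℝ, 0 < t →
            AEMeasurable (InverseStable.inverseProcess H t) P ∧
            (∀ x : ℝ, 0 < x → 0 ≤ InverseStable.invDensity (1 / (n : ℝ)) x t) ∧
            P.map (InverseStable.inverseProcess H t) =
              (volume.restrict (Ioi (0 : ℝ))).withDensity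
                (fun x => ENNReal.ofReal (InverseStable.invDensity (1 / (n : ℝ)) x t))) ∧
      -- regularity on `x > 0`, `t > 0`
      (∀ t : ℝ, 0 < t →
        ContDiffOn ℝ (⊤ : ℕ∞) (fun x => InverseStable.invDensity (1 / (n : ℝ)) x t) (Ioi 0)) ∧
      (∀ x : ℝ, 0 < x →
        ContDiffOn ℝ (⊤ : ℕ∞) (fun t => InverseStable.invDensity (1 / (n : ℝ)) x t) (Ioi 0)) ∧
      -- the equation
      (∀ x t : ℝ, 0 < x → 0 < t →
        InverseStable.DMinus 1 (fun s => InverseStable.invDensity (1 / (n : ℝ)) x s) t +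
          InverseStable.DMinus n (fun y => InverseStable.invDensity (1 / (n : ℝ)) y t) x = 0) ∧
      -- the initial condition `l(x,0) = δ(x)`
      (∀ t : ℝ, 0 < t →
        IntegrableOn (fun x => InverseStable.invDensity (1 / (n : ℝ)) x t) (Ioi 0)) ∧
      (∀ f : ℝ → ℝ, Continuous f → (∃ C : ℝ, ∀ x, |f x| ≤ C) →
        Tendsto (fun t => ∫ x in Ioi (0 : ℝ), f x * InverseStable.invDensity (1 / (n : ℝ)) x t)
          (𝓝[>] 0) (𝓝 (f 0))) ∧
      -- the boundary conditions
      (∀ t : ℝ, 0 < t →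
        InverseStable.invDensity (1 / (n : ℝ)) 0 t = InverseStable.Phi (1 / (n : ℝ)) t) ∧
      (∀ k : ℕ, k < n → ∀ t : ℝ, 0 < t →
        Tendsto (fun x =>
            InverseStable.DMinus k (fun y => InverseStable.invDensity (1 / (n : ℝ)) y t) x)
          (𝓝[>] 0) (𝓝 (InverseStable.Phi (((k : ℝ) + 1) / (n : ℝ)) t)))) ∧
    -- order one: the law is the unit mass at `t`, and the conditions hold for measures
    (n = 1 →
      ∀ (Ω : Type*) [MeasurableSpace Ω] (P : Measure Ω) [IsProbabilityMeasure P]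
        (H : ℝ≥0 → Ω → ℝ), InverseStable.IsStableSubordinator (1 / (n : ℝ)) H P →
        (∀ t : ℝ, 0 < t → AEMeasurable (InverseStable.inverseProcess H t) P ∧
          P.map (InverseStable.inverseProcess H t) = Measure.dirac t) ∧
        InverseStable.SolvesInDistributions n
          (fun t => P.map (InverseStable.inverseProcess H t)) ∧
        (∀ f : ℝ → ℝ, Continuous f → (∃ C : ℝ, ∀ x, |f x| ≤ C) →
          Tendsto (fun t => ∫ x, f x ∂(P.map (InverseStable.inverseProcess H t)))
            (𝓝[>] 0) (𝓝 (f 0))) ∧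
        (∀ t : ℝ, 0 < t →
          P.map (InverseStable.inverseProcess H t) (Iio t) = 0 ∧
            InverseStable.Phi 1 t = 0)) := by
  open InverseStable in
  refine ⟨fun hn2 => ⟨fun Ω _ P _ H hH t ht => ⟨?_, ?_, hH.map_inverseProcess hn2 ht⟩,
    fun t _ => contDiffOn_invDensity_left hn2 t, fun x _ => contDiffOn_invDensity_right hn2 x,
    fun x t _ ht => invDensity_equation hn2 x ht, fun t ht => integrableOn_invDensity hn2 ht,
    fun f hf ⟨C, hC⟩ => tendsto_integral_mul_invDensity hn2 hf hC,
    fun t ht => invDensity_zero_left ht, fun k _ t ht => tendsto_dMinus_invDensity hn2 k ht⟩, ?_⟩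
  · exact InverseStable.aemeasurable_inverseProcess hH.measurable hH.mono (hH.ae_exists_lt hn2 ht)
  · exact fun x hx => hH.invDensity_nonneg hn2 hx ht
  · rintro rfl Ω _ P _ H hH
    rw [Nat.cast_one, div_one] at hH
    have hmap (t : ℝ) (ht : 0 < t) := hH.map_inverseProcess_of_one ht
    refine ⟨hmap, InverseStable.solvesInDistributions_one_of_eq_dirac fun t ht => (hmap t ht).2,
      fun f hf _ => ?_, fun t ht => ⟨?_, ?_⟩⟩
    · refine (hf.continuousWithinAt (s := Ioi 0) (x := 0)).congr' ?_
      filter_upwards [self_mem_nhdsWithin] with t ht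
      rw [(hmap t ht).2, integral_dirac]
    · rw [(hmap t ht).2, Measure.dirac_apply' _ measurableSet_Iio]
      simp
    · simp [InverseStable.Phi]
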